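/- Let $-\infty\le a<b\le\infty$, let $\alpha,\beta,s$ be positive numbers, and let $f,g$ be non-negative (real-valued) Lebesgue measurable functions on $(a,b)$. Put $$F(y)=\int_y^b f(t)\,dt,\qquad G(y)=\int_a^y g(t)\,dt ,$$ and suppose that $F(y)<\infty$ and $G(y)<\infty$ for every $y\in(a,b)$. All quantities below are taken in $[0,\infty]$ with the conventions $0\cdot\infty=0$, $0^{p}=\infty$ and $\infty^{p}=0$ for $p<0$, and $0^0=1$; $\inf_{h\ge0}$ is the infimum over all non-negative real-valued Lebesgue measurable functions $h$ on $(a,b)$; and $X\approx Y$ means $C^{-1}X\le Y\le CX$ with a constant $C\in(0,\infty)$ depending only on $\alpha,\beta,s$ (in particular not on $x$, $a$, $b$, $f$, $g$). Then for every $x\in(a,b)$, the quantity $\sup_{x<y<b}F^\alpha(y)G^\beta(y)$ is equivalent ($\approx$) to each of (i) $\displaystyle\sup_{x<y<b}\Big(\int_y^b f(t)G^{\frac{\beta-s}{\alpha}}(t)\,dt\Big)^{\alpha}G^{s}(y)$; (ii) $\displaystyle\sup_{x<y<b}\Big(\int_x^y f(t)G^{\frac{\beta+s}{\alpha}}(t)\,dt\Big)^{\alpha}G^{-s}(y)$;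 (iii) $\displaystyle\sup_{x<y<b}\Big(\int_y^b f(t)G^{\frac{\beta}{\alpha+s}}(t)\,dt\Big)^{\alpha+s}F^{-s}(y)$; (iv) $\displaystyle\sup_{x<y<b}\Big(\int_x^y f(t)G^{\frac{\beta}{\alpha-s}}(t)\,dt\Big)^{\alpha-s}F^{s}(y)$, if $\alpha>s$; (v) $\displaystyle\sup_{x<y<b}\Big(\int_y^b f(t)G^{\frac{\beta}{\alpha-s}}(t)\,dt\Big)^{\alpha-s}F^{s}(y)$, if $\alpha<s$; (vi) $\displaystyle\inf_{h\ge0}\sup_{x<y<b}\Big(\int_y^b f(t)h^{\frac{\beta-s}{\alpha}}(t)\,dt\Big)^{\alpha}\big(h(y)+G(y)\big)^{s}$, if $\beta<s$; (vii) $\displaystyle\inf_{h\ge0}\sup_{x<y<b}\Big(\int_x^y f(t)\big(h(t)+G(t)\big)^{\frac{\beta+s}{\alpha}}\,dt\Big)^{\alpha}h^{-s}(y)$; and the quantity $\sup_{a<y<x}F^\alpha(y)G^\beta(y)$ is equivalent to each of (viii) $\displaystyle\sup_{a<y<x}\Big(\int_a^y g(t)F^{\frac{\alpha-s}{\beta}}(t)\,dt\Big)^{\beta}F^{s}(y)$;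 (ix) $\displaystyle\sup_{a<y<x}\Big(\int_y^x g(t)F^{\frac{\alpha+s}{\beta}}(t)\,dt\Big)^{\beta}F^{-s}(y)$; (x) $\displaystyle\sup_{a<y<x}\Big(\int_a^y g(t)F^{\frac{\alpha}{\beta+s}}(t)\,dt\Big)^{\beta+s}G^{-s}(y)$; (xi) $\displaystyle\sup_{a<y<x}\Big(\int_y^x g(t)F^{\frac{\alpha}{\beta-s}}(t)\,dt\Big)^{\beta-s}G^{s}(y)$, if $\beta>s$; (xii) $\displaystyle\sup_{a<y<x}\Big(\int_a^y g(t)F^{\frac{\alpha}{\beta-s}}(t)\,dt\Big)^{\beta-s}G^{s}(y)$, if $\beta<s$; (xiii) $\displaystyle\inf_{h\ge0}\sup_{a<y<x}\Big(\int_a^y g(t)h^{\frac{\alpha-s}{\beta}}(t)\,dt\Big)^{\beta}\big(h(y)+F(y)\big)^{s}$, if $\alpha<s$; (xiv) $\displaystyle\inf_{h\ge0}\sup_{a<y<x}\Big(\int_y^x g(t)\big(h(t)+F(t)\big)^{\frac{\alpha+s}{\beta}}\,dt\Big)^{\beta}h^{-s}(y)$. -/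

import Mathlib

open MeasureTheory
open scoped NNReal ENNReal

namespace HardyScales

/-- The open interval `(c, d)` of real numbers, where `c` and `d` may be infinite. -/
def ivl (c d : EReal) : Set ℝ := {t : ℝ | c < (t : EReal) ∧ (t : EReal) < d}

/-- Nonnegative (finite valued) Lebesgue measurable functions on `(a, b)`. Values outside of
`(a, b)` play no role. -/
def IsWeight (a b : EReal) (f : ℝ → ℝ≥0) : Prop :=
  AEMeasurable f (volume.restrict (ivl a b))

/-- `F(y) = ∫_y^b f(t) dt`. -/
noncomputable def tailInt (b : EReal) (f : ℝ → ℝ≥0) (y : ℝ) : ℝ≥0∞ :=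
  ∫⁻ t in ivl y b, (f t : ℝ≥0∞)

/-- `G(y) = ∫_a^y g(t) dt`. -/
noncomputable def headInt (a : EReal) (g : ℝ → ℝ≥0) (y : ℝ) : ℝ≥0∞ :=
  ∫⁻ t in ivl a y, (g t : ℝ≥0∞)

/-- `∫_c^d f(t) W(t)^p dt`. -/
noncomputable def wInt (c d : EReal) (f : ℝ → ℝ≥0) (W : ℝ → ℝ≥0∞) (p : ℝ) : ℝ≥0∞ :=
  ∫⁻ t in ivl c d, (f t : ℝ≥0∞) * W t ^ p

/-- `A ≈ B` in `[0, ∞]` with constant `C`. -/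
def EquivWith (C : ℝ≥0) (A B : ℝ≥0∞) : Prop := A ≤ C * B ∧ B ≤ C * A

/-! The functions `B_i(y)`. They take values in `[0, ∞]`, with `0 * ∞ = 0`, `0 ^ p = ∞` and
`∞ ^ p = 0` for `p < 0`. Here `F = tailInt b f` and `G = headInt a g`. -/

section functionals

variable (a b : EReal) (f g : ℝ → ℝ≥0) (α β s : ℝ)

/-- `F^α(y) G^β(y)` -/
noncomputable def B1 (y : ℝ) : ℝ≥0∞ := tailInt b f y ^ α * headInt a g y ^ β

/-- `(∫_y^b f G^((β-s)/α))^α G^s(y)` -/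
noncomputable def B2 (y : ℝ) : ℝ≥0∞ :=
  wInt y b f (headInt a g) ((β - s) / α) ^ α * headInt a g y ^ s

/-- `(∫_a^y g F^((α-s)/β))^β F^s(y)` -/
noncomputable def B3 (y : ℝ) : ℝ≥0∞ :=
  wInt a y g (tailInt b f) ((α - s) / β) ^ β * tailInt b f y ^ s

/-- `(∫_x^y f G^((β+s)/α))^α G^(-s)(y)`; here `G` is still the integral from `a`. -/
noncomputable def B4trunc (x y : ℝ) : ℝ≥0∞ :=
  wInt x y f (headInt a g) ((β + s) / α) ^ α * headInt a g y ^ (-s)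

/-- `(∫_y^x g F^((α+s)/β))^β F^(-s)(y)`; here `F` is still the integral up to `b`. -/
noncomputable def B5trunc (x y : ℝ) : ℝ≥0∞ :=
  wInt y x g (tailInt b f) ((α + s) / β) ^ β * tailInt b f y ^ (-s)

/-- `(∫_y^b f G^(β/(α+s)))^(α+s) F^(-s)(y)` -/
noncomputable def B6 (y : ℝ) : ℝ≥0∞ :=
  wInt y b f (headInt a g) (β / (α + s)) ^ (α + s) * tailInt b f y ^ (-s)

/-- `(∫_a^y g F^(α/(β+s)))^(β+s) G^(-s)(y)` -/
noncomputable def B7 (y : ℝ) : ℝ≥0∞ :=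
  wInt a y g (tailInt b f) (α / (β + s)) ^ (β + s) * headInt a g y ^ (-s)

/-- `(∫_x^y f G^(β/(α-s)))^(α-s) F^s(y)`, used for `s < α` -/
noncomputable def B8trunc (x y : ℝ) : ℝ≥0∞ :=
  wInt x y f (headInt a g) (β / (α - s)) ^ (α - s) * tailInt b f y ^ s

/-- `(∫_y^b f G^(β/(α-s)))^(α-s) F^s(y)`, used for `α < s` -/
noncomputable def B9 (y : ℝ) : ℝ≥0∞ :=
  wInt y b f (headInt a g) (β / (α - s)) ^ (α - s) * tailInt b f y ^ s

/-- `(∫_y^x g F^(α/(β-s)))^(β-s) G^s(y)`, used for `s < β` -/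
noncomputable def B10trunc (x y : ℝ) : ℝ≥0∞ :=
  wInt y x g (tailInt b f) (α / (β - s)) ^ (β - s) * headInt a g y ^ s

/-- `(∫_a^y g F^(α/(β-s)))^(β-s) G^s(y)`, used for `β < s` -/
noncomputable def B11 (y : ℝ) : ℝ≥0∞ :=
  wInt a y g (tailInt b f) (α / (β - s)) ^ (β - s) * headInt a g y ^ s

/-- `(∫_y^b f h^((β-s)/α))^α (h(y)+G(y))^s`, used for `β < s` -/
noncomputable def B12 (h : ℝ → ℝ≥0) (y : ℝ) : ℝ≥0∞ :=
  wInt y b f (fun t => (h t : ℝ≥0∞)) ((β - s) / α) ^ α * ((h y : ℝ≥0∞) + headInt a g y) ^ s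

/-- `(∫_a^y g h^((α-s)/β))^β (h(y)+F(y))^s`, used for `α < s` -/
noncomputable def B13 (h : ℝ → ℝ≥0) (y : ℝ) : ℝ≥0∞ :=
  wInt a y g (fun t => (h t : ℝ≥0∞)) ((α - s) / β) ^ β * ((h y : ℝ≥0∞) + tailInt b f y) ^ s

/-- `(∫_x^y f (h+G)^((β+s)/α))^α h^(-s)(y)` -/
noncomputable def B14trunc (h : ℝ → ℝ≥0) (x y : ℝ) : ℝ≥0∞ :=
  wInt x y f (fun t => (h t : ℝ≥0∞) + headInt a g t) ((β + s) / α) ^ α * (h y : ℝ≥0∞) ^ (-s)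

/-- `(∫_y^x g (h+F)^((α+s)/β))^β h^(-s)(y)` -/
noncomputable def B15trunc (h : ℝ → ℝ≥0) (x y : ℝ) : ℝ≥0∞ :=
  wInt y x g (fun t => (h t : ℝ≥0∞) + tailInt b f t) ((α + s) / β) ^ β * (h y : ℝ≥0∞) ^ (-s)

end functionals

/-- `sup_{c<y<d} B(y)` -/
noncomputable def supOn (c d : EReal) (B : ℝ → ℝ≥0∞) : ℝ≥0∞ := ⨆ y ∈ ivl c d, B y

/-- The infimum of `Φ h` over all nonnegative measurable functions `h` on `(a, b)`. -/
noncomputable def infWeights (a b : EReal) (Φ : (ℝ → ℝ≥0) → ℝ≥0∞) : ℝ≥0∞ :=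
  ⨅ (h : ℝ → ℝ≥0) (_ : IsWeight a b h), Φ h

end HardyScales

namespace HardyScales

/-! Let μ be the measure f dt on (a, b). It has no atoms and F(t) = μ((t, ∞)), while G enters only
as an increasing function. If F^α G^β ≤ A, then G^r ≤ A^(r/β) F^(-αr/β), so most upper bounds reduce
to integrating powers of F against dμ = -dF. In place of an exact primitive there are ∫_{t>y}
F^(γ-1) dμ ≲ F(y)^γ and ∫_{t<y} F^(-γ-1) dμ ≲ F(y)^(-γ) for γ > 0. Both come from {F ≤ r} having
measure at most r, by summing a geometric series over dyadic levels
(`exists_setLIntegral_rpow_le_of_dyadic`). For `B4trunc` the levels are those of G instead.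

Some reverse bounds only use that G increases. An integral that stops at y misses the mass beyond y,
so `exists_tail_split` supplies a point z > y such that (y, z) and (z, b) each carry a quarter of
F(y), and the quantity is evaluated at z.

The quantities with an infimum involve K = h + G, which need not be monotone. The remedy is a change
of measure, dν = K^p dμ: finiteness of the quantity bounds a power of K by tails or heads of ν, and
μ is recovered as K^(-p) dν, so the same power integrals apply to ν (`exists_le_tail_weighted`,
`exists_le_truncated_weighted`). The choice h = G bounds the infima by `B2` and `B4trunc`. This
closes the cycles, and also yields the lower bounds for `B4trunc`, and for `B2` when β < s. The
statements on (a, x) follow by the reflection t ↦ -t, which exchanges f with g and α with β. -/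

/-! ### Powers in [0, ∞] and dyadic summation. -/

theorem rpow_le_rpow_of_nonpos' {x y : ℝ≥0∞} {q : ℝ} (hq : q ≤ 0) (h : x ≤ y) :
    y ^ q ≤ x ^ q := by
  rw [← neg_neg q, ENNReal.rpow_neg y, ENNReal.rpow_neg x]
  exact ENNReal.inv_le_inv.2 (ENNReal.rpow_le_rpow h (neg_nonneg.2 hq))

theorem rpow_le_of_half_lt {u w : ℝ≥0∞} (q : ℝ) (hu' : u ≠ ∞)
    (h1 : u / 2 < w) (h2 : w ≤ u) : w ^ q ≤ 2 ^ |q| * u ^ q := by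
  rcases le_total 0 q with hq | hq
  · calc w ^ q ≤ u ^ q := ENNReal.rpow_le_rpow h2 hq
      _ = 1 * u ^ q := (one_mul _).symm
      _ ≤ 2 ^ |q| * u ^ q := by
        gcongr
        simpa using ENNReal.rpow_le_rpow (show (1 : ℝ≥0∞) ≤ 2 by norm_num) (abs_nonneg q)
  · rw [abs_of_nonpos hq]
    calc w ^ q ≤ (u / 2) ^ q := rpow_le_rpow_of_nonpos' hq h1.le
      _ = 2 ^ (-q) * u ^ q := by
        rw [div_eq_mul_inv, ENNReal.mul_rpow_of_ne_top hu' (by simp), ENNReal.inv_rpow,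
          ← ENNReal.rpow_neg, mul_comm]

theorem exists_dyadic_block {w M : ℝ≥0∞} (hw : 0 < w) (hwM : w ≤ M) (hM : M ≠ ∞) :
    ∃ k : ℕ, M * 2⁻¹ ^ k / 2 < w ∧ w ≤ M * 2⁻¹ ^ k := by
  have hM0 : 0 < M := hw.trans_le hwM
  lift M to ℝ≥0 using hM
  lift w to ℝ≥0 using (hwM.trans_lt ENNReal.coe_lt_top).ne
  have hM0' : 0 < M := by exact_mod_cast hM0
  have hw' : 0 < w := by exact_mod_cast hw
  have hwM' : w ≤ M := by exact_mod_cast hwM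
  obtain ⟨k, hk1, hk2⟩ := exists_nat_pow_near_of_lt_one (x := w / M) (y := (2⁻¹ : ℝ≥0))
    (by positivity) (by rw [div_le_one hM0']; exact hwM') (by norm_num)
    (NNReal.inv_lt_one_iff (by norm_num) |>.2 (by norm_num))
  refine ⟨k, ?_, ?_⟩
  · have h : M * 2⁻¹ ^ k / 2 < w := by
      rw [lt_div_iff₀ hM0'] at hk1
      calc M * 2⁻¹ ^ k / 2 = 2⁻¹ ^ (k + 1) * M := by rw [pow_succ]; ring
        _ < w := hk1
    have := ENNReal.coe_lt_coe.2 h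
    rwa [ENNReal.coe_div (by norm_num), ENNReal.coe_mul, ENNReal.coe_pow,
      ENNReal.coe_inv (by norm_num)] at this
  · have h : w ≤ M * 2⁻¹ ^ k := by
      rw [div_le_iff₀ hM0'] at hk2
      rwa [mul_comm]
    have := ENNReal.coe_le_coe.2 h
    rwa [ENNReal.coe_mul, ENNReal.coe_pow, ENNReal.coe_inv (by norm_num)] at this

/-- If the dyadic blocks of `W` have measure at most `K u ^ (-p)` and `p < q`, then the integral of
`W ^ q` over `{0 < W ≤ M}` is controlled by the top block. -/
theorem exists_setLIntegral_rpow_le_of_dyadic {p q : ℝ} (hpq : p < q) :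
    ∃ C : ℝ≥0, ∀ (ν : Measure ℝ) (W : ℝ → ℝ≥0∞) (K M : ℝ≥0∞), Measurable W → M ≠ ∞ →
      (∀ u, u ≠ 0 → u ≤ M → ν {t | u / 2 < W t ∧ W t ≤ u} ≤ K * u ^ (-p)) →
      ∫⁻ t in {t | 0 < W t ∧ W t ≤ M}, W t ^ q ∂ν ≤ C * (K * M ^ (q - p)) := by
  -- Ratio of the geometric series: the block at height M 2^(-k) contributes at most a constant
  -- times K M^(q-p) r^k, and p < q gives r < 1.
  set r : ℝ≥0∞ := 2⁻¹ ^ (q - p) with hr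
  have hr1 : r < 1 := ENNReal.rpow_lt_one (by simp) (by linarith)
  have hC : (2 : ℝ≥0∞) ^ |q| * (1 - r)⁻¹ ≠ ∞ :=
    ENNReal.mul_ne_top (by simp) (ENNReal.inv_ne_top.2 (tsub_pos_of_lt hr1).ne')
  refine ⟨((2 : ℝ≥0∞) ^ |q| * (1 - r)⁻¹).toNNReal, fun ν W K M hW hM hν => ?_⟩
  rw [ENNReal.coe_toNNReal hC]
  rcases eq_or_ne M 0 with rfl | hM0
  · have : {t | 0 < W t ∧ W t ≤ 0} = ∅ := by
      ext t
      exact iff_of_false (fun h => h.1.not_ge h.2) id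
    rw [this, Measure.restrict_empty, lintegral_zero_measure]
    exact zero_le
  set u : ℕ → ℝ≥0∞ := fun k => M * 2⁻¹ ^ k with hu
  have hu0 : ∀ k, u k ≠ 0 := fun k => mul_ne_zero hM0 (pow_ne_zero _ (by simp))
  have huT : ∀ k, u k ≠ ∞ := fun k => ENNReal.mul_ne_top hM (ENNReal.pow_ne_top (by simp))
  have huM : ∀ k, u k ≤ M := fun k =>
    mul_le_of_le_one_right' (pow_le_one₀ zero_le (by simp))
  have hblock : ∀ k, MeasurableSet {t | u k / 2 < W t ∧ W t ≤ u k} := fun k =>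
    (measurableSet_lt measurable_const hW).inter (measurableSet_le hW measurable_const)
  calc ∫⁻ t in {t | 0 < W t ∧ W t ≤ M}, W t ^ q ∂ν
      ≤ ∫⁻ t in ⋃ k, {t | u k / 2 < W t ∧ W t ≤ u k}, W t ^ q ∂ν := by
        refine lintegral_mono_set fun t ht => ?_
        obtain ⟨k, hk⟩ := exists_dyadic_block ht.1 ht.2 hM
        exact Set.mem_iUnion.2 ⟨k, hk⟩
    _ ≤ ∑' k, ∫⁻ t in {t | u k / 2 < W t ∧ W t ≤ u k}, W t ^ q ∂ν := lintegral_iUnion_le _ _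
    _ ≤ ∑' k, 2 ^ |q| * (K * M ^ (q - p)) * r ^ k := by
        refine ENNReal.tsum_le_tsum fun k => ?_
        calc ∫⁻ t in {t | u k / 2 < W t ∧ W t ≤ u k}, W t ^ q ∂ν
            ≤ ∫⁻ t in {t | u k / 2 < W t ∧ W t ≤ u k}, 2 ^ |q| * u k ^ q ∂ν :=
              setLIntegral_mono' (hblock k) fun t ht =>
                rpow_le_of_half_lt q (huT k) ht.1 ht.2
          _ = 2 ^ |q| * u k ^ q * ν {t | u k / 2 < W t ∧ W t ≤ u k} := setLIntegral_const _ _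
          _ ≤ 2 ^ |q| * u k ^ q * (K * u k ^ (-p)) := by
              gcongr
              exact hν _ (hu0 k) (huM k)
          _ = 2 ^ |q| * (K * (u k) ^ (q - p)) := by
              rw [sub_eq_add_neg, ENNReal.rpow_add _ _ (hu0 k) (huT k)]
              ring
          _ = 2 ^ |q| * (K * M ^ (q - p)) * r ^ k := by
              rw [hu, ENNReal.mul_rpow_of_nonneg _ _ (by linarith : 0 ≤ q - p), hr,
                ← ENNReal.rpow_natCast, ← ENNReal.rpow_natCast, ← ENNReal.rpow_mul,
                ← ENNReal.rpow_mul, mul_comm (k : ℝ)]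
              ring
    _ = 2 ^ |q| * (1 - r)⁻¹ * (K * M ^ (q - p)) := by
        rw [ENNReal.tsum_mul_left, ENNReal.tsum_geometric]
        ring

/-! ### Power integrals of tails and heads of an atomless measure. -/

/-- Apart from its least point, which is null, an upper set is a countable directed union of open
rays with rational endpoints in it; continuity from below then needs no finiteness of ν. -/
theorem measure_le_of_isUpperSet {ν : Measure ℝ} [NullSingletonClass ν] {S : Set ℝ} {D : ℝ≥0∞}
    (hS : IsUpperSet S) (h : ∀ t ∈ S, ν (Set.Ioi t) ≤ D) : ν S ≤ D := by
  set Q : Set ℚ := {q | (q : ℝ) ∈ S}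
  have hsub : S ⊆ (⋃ q ∈ Q, Set.Ioi (q : ℝ)) ∪ {t | IsLeast S t} := by
    intro t ht
    by_cases hl : IsLeast S t
    · exact Or.inr hl
    · obtain ⟨r, hr, hrt⟩ : ∃ r ∈ S, r < t := by
        by_contra! hcon
        exact hl ⟨ht, hcon⟩
      obtain ⟨q, hq1, hq2⟩ := exists_rat_btwn hrt
      exact Or.inl (Set.mem_biUnion (show q ∈ Q from hS hq1.le hr) hq2)
  have hsing : ν {t | IsLeast S t} = 0 :=
    Set.Subsingleton.measure_zero (fun t ht r hr => ht.unique hr) ν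
  have hdir : DirectedOn (Function.onFun (· ⊆ ·) fun q : ℚ => Set.Ioi (q : ℝ)) Q := by
    intro p hp q hq
    rcases le_total p q with hpq | hpq
    · exact ⟨p, hp, subset_rfl, Set.Ioi_subset_Ioi (by exact_mod_cast hpq)⟩
    · exact ⟨q, hq, Set.Ioi_subset_Ioi (by exact_mod_cast hpq), subset_rfl⟩
  calc ν S ≤ ν (⋃ q ∈ Q, Set.Ioi (q : ℝ)) + ν {t | IsLeast S t} :=
        (measure_mono hsub).trans (measure_union_le _ _)
    _ ≤ D := by
        rw [hsing, add_zero, measure_biUnion_eq_iSup Q.to_countable hdir]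
        exact iSup₂_le fun q hq => h _ hq

theorem measure_le_of_isLowerSet {ν : Measure ℝ} [NullSingletonClass ν] {S : Set ℝ} {D : ℝ≥0∞}
    (hS : IsLowerSet S) (h : ∀ t ∈ S, ν (Set.Iio t) ≤ D) : ν S ≤ D := by
  set Q : Set ℚ := {q | (q : ℝ) ∈ S}
  have hsub : S ⊆ (⋃ q ∈ Q, Set.Iio (q : ℝ)) ∪ {t | IsGreatest S t} := by
    intro t ht
    by_cases hl : IsGreatest S t
    · exact Or.inr hl
    · obtain ⟨r, hr, hrt⟩ : ∃ r ∈ S, t < r := by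
        by_contra! hcon
        exact hl ⟨ht, hcon⟩
      obtain ⟨q, hq1, hq2⟩ := exists_rat_btwn hrt
      exact Or.inl (Set.mem_biUnion (show q ∈ Q from hS hq2.le hr) hq1)
  have hsing : ν {t | IsGreatest S t} = 0 :=
    Set.Subsingleton.measure_zero (fun t ht r hr => ht.unique hr) ν
  have hdir : DirectedOn (Function.onFun (· ⊆ ·) fun q : ℚ => Set.Iio (q : ℝ)) Q := by
    intro p hp q hq
    rcases le_total p q with hpq | hpq
    · exact ⟨q, hq, Set.Iio_subset_Iio (by exact_mod_cast hpq), subset_rfl⟩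
    · exact ⟨p, hp, subset_rfl, Set.Iio_subset_Iio (by exact_mod_cast hpq)⟩
  calc ν S ≤ ν (⋃ q ∈ Q, Set.Iio (q : ℝ)) + ν {t | IsGreatest S t} :=
        (measure_mono hsub).trans (measure_union_le _ _)
    _ ≤ D := by
        rw [hsing, add_zero, measure_biUnion_eq_iSup Q.to_countable hdir]
        exact iSup₂_le fun q hq => h _ hq

theorem antitone_measure_Ioi (ν : Measure ℝ) : Antitone fun t => ν (Set.Ioi t) :=
  fun _ _ h => measure_mono (Set.Ioi_subset_Ioi h)

theorem monotone_measure_Iio (ν : Measure ℝ) : Monotone fun t => ν (Set.Iio t) :=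
  fun _ _ h => measure_mono (Set.Iio_subset_Iio h)

/-- Substitute for the change of variable r = F(t): the sublevel sets of the tail are no larger than
those of the identity under Lebesgue measure on (0, ∞). -/
theorem measure_Ioi_le_le {ν : Measure ℝ} [NullSingletonClass ν] (r : ℝ≥0∞) :
    ν {t | ν (Set.Ioi t) ≤ r} ≤ r :=
  measure_le_of_isUpperSet (fun _ _ h hr => (antitone_measure_Ioi ν h).trans hr) fun _ h => h

theorem measure_Iio_le_le {ν : Measure ℝ} [NullSingletonClass ν] (r : ℝ≥0∞) :
    ν {t | ν (Set.Iio t) ≤ r} ≤ r :=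
  measure_le_of_isLowerSet (fun _ _ h hr => (monotone_measure_Iio ν h).trans hr) fun _ h => h

/-- Up to a constant this is ∫ F^(γ-1) d(-F) = F^γ/γ. It is the dyadic sum with p = -1, since a
block at height u has measure at most u. -/
theorem exists_setLIntegral_tail_rpow_le {γ : ℝ} (hγ : 0 < γ) :
    ∃ C : ℝ≥0, ∀ (ν : Measure ℝ) [NullSingletonClass ν] (y : ℝ), ν (Set.Ioi y) ≠ ∞ →
      ∫⁻ t in Set.Ioi y, ν (Set.Ioi t) ^ (γ - 1) ∂ν ≤ C * ν (Set.Ioi y) ^ γ := by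
  obtain ⟨C, hC⟩ := exists_setLIntegral_rpow_le_of_dyadic (show (-1 : ℝ) < γ - 1 by linarith)
  refine ⟨C, fun ν _ y hy => ?_⟩
  have key := hC ν (fun t => ν (Set.Ioi t)) 1 (ν (Set.Ioi y)) (antitone_measure_Ioi ν).measurable hy
    (fun u _ _ => by
      simpa using (measure_mono fun t ht => ht.2).trans (measure_Ioi_le_le (ν := ν) u))
  rw [one_mul, sub_neg_eq_add, sub_add_cancel] at key
  refine le_trans ?_ key
  -- For γ < 1 the integrand is infinite where the tail vanishes; those points form a null set.
  have h0 : ν {t | ν (Set.Ioi t) ≤ 0} = 0 := le_antisymm (measure_Ioi_le_le 0) zero_le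
  refine lintegral_mono' (Measure.restrict_mono_ae ?_) le_rfl
  filter_upwards [measure_eq_zero_iff_ae_notMem.1 h0] with t ht hty
  exact ⟨not_le.1 ht, antitone_measure_Ioi ν (le_of_lt hty)⟩

/-- Dyadic summation for 1/W: the block u/2 < 1/W ≤ u lies in {W ≤ 2/u}, of measure at most 2/u, so
p = 1 and K u^(-p) = 2/u. With W a tail or a head it covers both negative-power estimates below. -/
theorem exists_setLIntegral_rpow_le_of_measure_lt_le {γ : ℝ} (hγ : 0 < γ) :
    ∃ C : ℝ≥0, ∀ (ν : Measure ℝ) (W : ℝ → ℝ≥0∞) (m : ℝ≥0∞), Measurable W → m ≠ 0 →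
      (∀ r, ν {t | W t ≤ r} ≤ r) →
      ∫⁻ t in {t | m ≤ W t}, W t ^ (-γ - 1) ∂ν ≤ C * m ^ (-γ) := by
  obtain ⟨C, hC⟩ := exists_setLIntegral_rpow_le_of_dyadic (show (1 : ℝ) < γ + 1 by linarith)
  refine ⟨C * 2, fun ν W m hW hm hν => ?_⟩
  have key := hC ν (fun t => (W t)⁻¹) 2 m⁻¹ hW.inv (ENNReal.inv_ne_top.2 hm) (fun u _ _ => by
    rw [ENNReal.rpow_neg_one]
    refine (measure_mono fun t ht => ?_).trans ((hν (2 * u⁻¹)))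
    have h := ENNReal.inv_le_inv.2 (le_of_lt ht.1)
    rwa [inv_inv, ENNReal.inv_div (by simp) (by simp), div_eq_mul_inv] at h)
  simp only [ENNReal.inv_rpow, ← ENNReal.rpow_neg] at key
  rw [add_sub_cancel_right, ← mul_assoc, neg_add'] at key
  refine le_trans ?_ key
  have hset : MeasurableSet {t | m ≤ W t} := measurableSet_le measurable_const hW
  have hset' : MeasurableSet {t | 0 < (W t)⁻¹ ∧ (W t)⁻¹ ≤ m⁻¹} :=
    (measurableSet_lt measurable_const hW.inv).inter (measurableSet_le hW.inv measurable_const)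
  rw [← lintegral_indicator hset, ← lintegral_indicator hset']
  refine lintegral_mono fun t => ?_
  refine Set.indicator_le' (fun t ht => ?_) (fun _ _ => zero_le) t
  rcases eq_or_ne (W t) ∞ with h | h
  · rw [h, ENNReal.top_rpow_of_neg (by linarith)]
    exact zero_le
  · rw [Set.indicator_of_mem]
    exact ⟨ENNReal.inv_pos.2 h, ENNReal.inv_le_inv.2 ht⟩

theorem exists_setLIntegral_Iio_tail_rpow_le {γ : ℝ} (hγ : 0 < γ) :
    ∃ C : ℝ≥0, ∀ (ν : Measure ℝ) [NullSingletonClass ν] (y : ℝ), ν (Set.Ioi y) ≠ 0 →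
      ∫⁻ t in Set.Iio y, ν (Set.Ioi t) ^ (-γ - 1) ∂ν ≤ C * ν (Set.Ioi y) ^ (-γ) := by
  obtain ⟨C, hC⟩ := exists_setLIntegral_rpow_le_of_measure_lt_le hγ
  refine ⟨C, fun ν _ y hy => le_trans (lintegral_mono_set fun t ht => ?_)
    (hC ν (fun t => ν (Set.Ioi t)) _ (antitone_measure_Ioi ν).measurable hy measure_Ioi_le_le)⟩
  exact antitone_measure_Ioi ν (le_of_lt ht)

theorem exists_setLIntegral_Ioi_head_rpow_le {γ : ℝ} (hγ : 0 < γ) :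
    ∃ C : ℝ≥0, ∀ (ν : Measure ℝ) [NullSingletonClass ν] (y : ℝ), ν (Set.Iio y) ≠ 0 →
      ∫⁻ t in Set.Ioi y, ν (Set.Iio t) ^ (-γ - 1) ∂ν ≤ C * ν (Set.Iio y) ^ (-γ) := by
  obtain ⟨C, hC⟩ := exists_setLIntegral_rpow_le_of_measure_lt_le hγ
  refine ⟨C, fun ν _ y hy => le_trans (lintegral_mono_set fun t ht => ?_)
    (hC ν (fun t => ν (Set.Iio t)) _ (monotone_measure_Iio ν).measurable hy measure_Iio_le_le)⟩
  exact monotone_measure_Iio ν (le_of_lt ht)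

/-- A tail of a measure without atoms can be split into two comparable parts. -/
theorem exists_tail_split {ν : Measure ℝ} [NullSingletonClass ν] {y : ℝ}
    (h0 : ν (Set.Ioi y) ≠ 0) (hT : ν (Set.Ioi y) ≠ ∞) :
    ∃ z, y < z ∧ ν (Set.Ioi y) / 4 ≤ ν (Set.Ioi z) ∧ ν (Set.Ioi y) / 4 ≤ ν (Set.Ioo y z) := by
  set c := ν (Set.Ioi y) with hc
  -- Without such a z, (y, ∞) is covered by the upper set where the tail is at most c/4 and by its
  -- complement, whose part beyond y also has measure at most c/4. Hence c ≤ c/2. Any fraction below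
  -- one half would serve.
  by_contra! hcon
  have h1 : ν {t | ν (Set.Ioi t) ≤ c / 4} ≤ c / 4 := measure_Ioi_le_le _
  set S : Set ℝ := {t | c / 4 < ν (Set.Ioi t)} with hS
  have h2 : ν.restrict (Set.Ioi y) S ≤ c / 4 := by
    refine measure_le_of_isLowerSet (fun s t hts hs => lt_of_lt_of_le hs
      (antitone_measure_Ioi ν hts)) fun t ht => ?_
    rw [Measure.restrict_apply measurableSet_Iio, Set.inter_comm, Set.Ioi_inter_Iio]
    rcases le_or_gt t y with hty | hty
    · simp [Set.Ioo_eq_empty hty.not_gt]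
    · exact (hcon t hty (le_of_lt ht)).le
  have h3 : c ≤ c / 4 + c / 4 := by
    calc c ≤ ν ({t | ν (Set.Ioi t) ≤ c / 4} ∪ S ∩ Set.Ioi y) := measure_mono fun t ht => by
          rcases le_or_gt (ν (Set.Ioi t)) (c / 4) with h | h
          · exact Or.inl h
          · exact Or.inr ⟨h, ht⟩
      _ ≤ c / 4 + c / 4 := by
          refine (measure_union_le _ _).trans (add_le_add h1 ?_)
          rwa [← Measure.restrict_apply' measurableSet_Ioi]
  lift c to ℝ≥0 using hT with d
  have hd : 0 < d := by
    rw [pos_iff_ne_zero]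
    exact_mod_cast h0
  have h4 : d ≤ d / 4 + d / 4 := by
    have : ((d / 4 + d / 4 : ℝ≥0) : ℝ≥0∞) = d / 4 + d / 4 := by
      rw [ENNReal.coe_add, ENNReal.coe_div (by norm_num)]
      rfl
    rw [← this] at h3
    exact_mod_cast h3
  have h5 : (d : ℝ) ≤ d / 4 + d / 4 := by exact_mod_cast h4
  have : (0 : ℝ) < d := by exact_mod_cast hd
  linarith

/-! ### The abstract setting: an atomless measure and an increasing function. -/

/-- A measure `μ` whose tails `μ (Ioi t)` play the role of `F`, together with an increasing
function `G`, considered on the interval `(x, b)`. -/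
structure TailSetting (μ : Measure ℝ) (G : ℝ → ℝ≥0∞) (x : ℝ) (b : EReal) : Prop where
  noAtoms : NullSingletonClass μ
  mono : Monotone G
  ae_lt : ∀ᵐ t : ℝ ∂μ, (t : EReal) < b
  tail_ne_top : μ (Set.Ioi x) ≠ ∞
  ne_top : ∀ t ∈ ivl x b, G t ≠ ∞

namespace TailSetting

variable {μ : Measure ℝ} {G : ℝ → ℝ≥0∞} {x : ℝ} {b : EReal}

theorem tail_ne_top_of_mem (h : TailSetting μ G x b) {y : ℝ} (hy : y ∈ ivl x b) :
    μ (Set.Ioi y) ≠ ∞ :=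
  ((antitone_measure_Ioi μ (EReal.coe_le_coe_iff.1 hy.1.le)).trans_lt h.tail_ne_top.lt_top).ne

theorem lt_of_tail_ne_zero (h : TailSetting μ G x b) {y : ℝ} (hy : μ (Set.Ioi y) ≠ 0) :
    (y : EReal) < b := by
  by_contra! hb
  refine hy (measure_mono_null (fun t ht => ?_) (ae_iff.1 h.ae_lt))
  exact not_lt.2 (hb.trans (EReal.coe_le_coe_iff.2 (le_of_lt ht)))

theorem ae_mem (h : TailSetting μ G x b) {y : ℝ} (hy : y ∈ ivl x b) :
    ∀ᵐ t ∂μ.restrict (Set.Ioi y), y < t ∧ t ∈ ivl x b := by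
  filter_upwards [ae_restrict_mem measurableSet_Ioi, ae_restrict_of_ae h.ae_lt] with t ht htb
  exact ⟨ht, hy.1.trans (EReal.coe_lt_coe_iff.2 ht), htb⟩

theorem ae_tail_ne_zero (h : TailSetting μ G x b) : ∀ᵐ t ∂μ, μ (Set.Ioi t) ≠ 0 := by
  have := h.noAtoms
  have h0 : μ {t | μ (Set.Ioi t) ≤ 0} = 0 := le_antisymm (measure_Ioi_le_le 0) zero_le
  filter_upwards [measure_eq_zero_iff_ae_notMem.1 h0] with t ht h
  exact ht h.le

end TailSetting

theorem rpow_mul_rpow_neg {u : ℝ≥0∞} (hu : u ≠ 0) (hu' : u ≠ ∞) (s : ℝ) :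
    u ^ s * u ^ (-s) = 1 := by
  rw [← ENNReal.rpow_add _ _ hu hu', add_neg_cancel, ENNReal.rpow_zero]

/-- Solving `u ^ α * v ^ β ≤ A` for a power of `v`. -/
theorem rpow_le_of_mul_rpow_le {u v A : ℝ≥0∞} {α β r : ℝ} (hβ : 0 < β) (hr : 0 ≤ r)
    (hu : u ≠ 0) (hu' : u ≠ ∞) (h : u ^ α * v ^ β ≤ A) :
    v ^ r ≤ A ^ (r / β) * u ^ (-(α * r / β)) := by
  have h1 : v ^ β ≤ A * u ^ (-α) := by
    calc v ^ β = u ^ α * v ^ β * u ^ (-α) := by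
          rw [mul_right_comm, rpow_mul_rpow_neg hu hu', one_mul]
      _ ≤ A * u ^ (-α) := by gcongr
  calc v ^ r = (v ^ β) ^ (r / β) := by
        rw [← ENNReal.rpow_mul, mul_div_cancel₀ _ hβ.ne']
    _ ≤ (A * u ^ (-α)) ^ (r / β) := by gcongr
    _ = A ^ (r / β) * u ^ (-(α * r / β)) := by
        rw [ENNReal.mul_rpow_of_nonneg _ _ (by positivity), ← ENNReal.rpow_mul]
        congr 2
        ring

theorem const_mul_measure_le_setLIntegral {μ : Measure ℝ} {S : Set ℝ} (hS : MeasurableSet S)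
    {c : ℝ≥0∞} {φ : ℝ → ℝ≥0∞} (h : ∀ t ∈ S, c ≤ φ t) : c * μ S ≤ ∫⁻ t in S, φ t ∂μ := by
  rw [← setLIntegral_const]
  exact setLIntegral_mono' hS h

/-! ### Estimates for `B2`, `B4trunc` and `B6`. -/

section bounds

variable {α β s : ℝ}

/-- If β < s, the exponent on G is negative and G(t) ≥ G(y) suffices. If β ≥ s, the bound on G^p in
terms of F leaves the integrand F^(s/β - 1), which integrates to F(y)^(s/β). -/
theorem exists_tail_weighted_le (hα : 0 < α) (hβ : 0 < β) (hs : 0 < s) :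
    ∃ C : ℝ≥0, ∀ (μ : Measure ℝ) (G : ℝ → ℝ≥0∞) (x : ℝ) (b : EReal), TailSetting μ G x b →
      ∀ A, (∀ t ∈ ivl x b, μ (Set.Ioi t) ^ α * G t ^ β ≤ A) → ∀ y ∈ ivl x b,
        (∫⁻ t in Set.Ioi y, G t ^ ((β - s) / α) ∂μ) ^ α * G y ^ s ≤ C * A := by
  rcases lt_or_ge β s with hβs | hβs
  · refine ⟨1, fun μ G x b h A hA y hy => ?_⟩
    rcases eq_or_ne (G y) 0 with h0 | h0
    · simp [h0, hs]
    have h1 : ∫⁻ t in Set.Ioi y, G t ^ ((β - s) / α) ∂μ ≤ G y ^ ((β - s) / α) * μ (Set.Ioi y) := by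
      rw [← setLIntegral_const]
      exact setLIntegral_mono' measurableSet_Ioi fun t ht => rpow_le_rpow_of_nonpos'
        (div_nonpos_of_nonpos_of_nonneg (by linarith) hα.le) (h.mono (le_of_lt ht))
    calc (∫⁻ t in Set.Ioi y, G t ^ ((β - s) / α) ∂μ) ^ α * G y ^ s
        ≤ (G y ^ ((β - s) / α) * μ (Set.Ioi y)) ^ α * G y ^ s := by gcongr
      _ = μ (Set.Ioi y) ^ α * G y ^ β := by
          rw [ENNReal.mul_rpow_of_nonneg _ _ hα.le, ← ENNReal.rpow_mul,
            div_mul_cancel₀ _ hα.ne', mul_right_comm, ← ENNReal.rpow_add _ _ h0 (h.ne_top y hy),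
            sub_add_cancel, mul_comm]
      _ ≤ (1 : ℝ≥0) * A := by simpa using hA y hy
  · obtain ⟨C, hC⟩ := exists_setLIntegral_tail_rpow_le (div_pos hs hβ)
    refine ⟨C ^ α, fun μ G x b h A hA y hy => ?_⟩
    have := h.noAtoms
    set p := (β - s) / α with hp
    have hp0 : 0 ≤ p := div_nonneg (by linarith) hα.le
    have hpα : p / β * α = (β - s) / β := by rw [hp]; field_simp
    have h1 : ∫⁻ t in Set.Ioi y, G t ^ p ∂μ ≤ A ^ (p / β) * (C * μ (Set.Ioi y) ^ (s / β)) := by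
      calc ∫⁻ t in Set.Ioi y, G t ^ p ∂μ
          ≤ ∫⁻ t in Set.Ioi y, A ^ (p / β) * μ (Set.Ioi t) ^ (s / β - 1) ∂μ := by
            refine lintegral_mono_ae ?_
            filter_upwards [h.ae_mem hy, ae_restrict_of_ae h.ae_tail_ne_zero] with t ht ht0
            refine (rpow_le_of_mul_rpow_le hβ hp0 ht0 (h.tail_ne_top_of_mem ht.2)
              (hA t ht.2)).trans_eq ?_
            congr 2
            rw [hp]
            field_simp
            ring
        _ = A ^ (p / β) * ∫⁻ t in Set.Ioi y, μ (Set.Ioi t) ^ (s / β - 1) ∂μ :=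
            lintegral_const_mul _ ((antitone_measure_Ioi μ).measurable.pow_const _)
        _ ≤ _ := by
            gcongr
            exact hC μ y (h.tail_ne_top_of_mem hy)
    calc (∫⁻ t in Set.Ioi y, G t ^ p ∂μ) ^ α * G y ^ s
        ≤ (A ^ (p / β) * (C * μ (Set.Ioi y) ^ (s / β))) ^ α * G y ^ s := by gcongr
      _ = C ^ α * (A ^ ((β - s) / β) * (μ (Set.Ioi y) ^ α * G y ^ β) ^ (s / β)) := by
          rw [ENNReal.mul_rpow_of_nonneg _ _ hα.le, ENNReal.mul_rpow_of_nonneg _ _ hα.le,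
            ENNReal.mul_rpow_of_nonneg _ _ (by positivity : 0 ≤ s / β)]
          simp only [← ENNReal.rpow_mul]
          rw [hpα, mul_comm (s / β) α, mul_div_cancel₀ _ hβ.ne']
          ring
      _ ≤ C ^ α * (A ^ ((β - s) / β) * A ^ (s / β)) := by
          gcongr
          exact hA y hy
      _ = (C ^ α : ℝ≥0) * A := by
          rw [← ENNReal.rpow_add_of_nonneg _ _ (div_nonneg (by linarith) hβ.le) (by positivity),
            ← add_div, sub_add_cancel, div_self hβ.ne', ENNReal.rpow_one,
            ENNReal.coe_rpow_of_nonneg _ hα.le]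

/-- Replacing G by a power of F would produce F(y) on the right, where G(y) is needed, so the dyadic
levels are those of G. The set {G > u/2} is an upper set on which F ≤ A^(1/α) (u/2)^(-β/α), so p =
β/α and the top level u = G(y) dominates. -/
theorem exists_truncated_weighted_le (hα : 0 < α) (hβ : 0 < β) (hs : 0 < s) :
    ∃ C : ℝ≥0, ∀ (μ : Measure ℝ) (G : ℝ → ℝ≥0∞) (x : ℝ) (b : EReal), TailSetting μ G x b →
      ∀ A, (∀ t ∈ ivl x b, μ (Set.Ioi t) ^ α * G t ^ β ≤ A) → ∀ y ∈ ivl x b,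
        (∫⁻ t in Set.Ioo x y, G t ^ ((β + s) / α) ∂μ) ^ α * G y ^ (-s) ≤ C * A := by
  obtain ⟨C, hC⟩ := exists_setLIntegral_rpow_le_of_dyadic
    (show β / α < (β + s) / α by gcongr; linarith)
  refine ⟨(C * 2 ^ (β / α)) ^ α, fun μ G x b h A hA y hy => ?_⟩
  have := h.noAtoms
  have hq0 : 0 < (β + s) / α := by positivity
  have hdiff : (β + s) / α - β / α = s / α := by ring
  have hGm := h.mono.measurable
  have h1 : ∫⁻ t in Set.Ioo x y, G t ^ ((β + s) / α) ∂μ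
      ≤ C * (A ^ (1 / α) * 2 ^ (β / α) * G y ^ (s / α)) := by
    have key := hC (μ.restrict (Set.Ioo x y)) G (A ^ (1 / α) * 2 ^ (β / α)) (G y) hGm
      (h.ne_top y hy) fun u hu huy => by
        have huT : u ≠ ∞ := (huy.trans_lt (h.ne_top y hy).lt_top).ne
        have hu2 : u / 2 ≠ 0 := (ENNReal.half_pos hu).ne'
        have hu2T : u / 2 ≠ ∞ := (ENNReal.half_lt_self hu huT).ne_top
        rw [Measure.restrict_apply' measurableSet_Ioo]
        have hup : IsUpperSet {t | x < t ∧ u / 2 < G t} := fun c d hcd hc =>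
          ⟨hc.1.trans_le hcd, hc.2.trans_le (h.mono hcd)⟩
        refine (measure_mono fun t ht => ?_).trans (measure_le_of_isUpperSet hup fun t ht => ?_)
        · exact ⟨ht.2.1, ht.1.1⟩
        · rcases eq_or_ne (μ (Set.Ioi t)) 0 with h0 | h0
          · rw [h0]
            exact zero_le
          have htb : t ∈ ivl x b := ⟨EReal.coe_lt_coe_iff.2 ht.1, h.lt_of_tail_ne_zero h0⟩
          have hle : (u / 2) ^ β * μ (Set.Ioi t) ^ α ≤ A := by
            rw [mul_comm]
            refine le_trans ?_ (hA t htb)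
            have := ht.2.le
            gcongr
          have := rpow_le_of_mul_rpow_le hα zero_le_one hu2 hu2T hle
          rw [ENNReal.rpow_one, mul_one] at this
          refine this.trans_eq ?_
          rw [mul_assoc]
          congr 1
          rw [div_eq_mul_inv u, ENNReal.mul_rpow_of_ne_top huT (by simp), ENNReal.inv_rpow,
            ← ENNReal.rpow_neg, neg_neg, mul_comm]
    rw [hdiff] at key
    refine le_trans ?_ key
    have hset : MeasurableSet {t | 0 < G t ∧ G t ≤ G y} :=
      (measurableSet_lt measurable_const hGm).inter (measurableSet_le hGm measurable_const)
    rw [← lintegral_indicator hset]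
    refine setLIntegral_mono' measurableSet_Ioo fun t ht => ?_
    rcases eq_or_ne (G t) 0 with h0 | h0
    · rw [h0, ENNReal.zero_rpow_of_pos hq0]
      exact zero_le
    · rw [Set.indicator_of_mem]
      exact ⟨pos_iff_ne_zero.2 h0, h.mono ht.2.le⟩
  have h2 : (∫⁻ t in Set.Ioo x y, G t ^ ((β + s) / α) ∂μ) ^ α
      ≤ ((C * 2 ^ (β / α)) ^ α : ℝ≥0) * A * G y ^ s := by
    refine (ENNReal.rpow_le_rpow h1 hα.le).trans_eq ?_
    rw [show (C : ℝ≥0∞) * (A ^ (1 / α) * 2 ^ (β / α) * G y ^ (s / α))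
      = ((C * 2 ^ (β / α) : ℝ≥0) : ℝ≥0∞) * A ^ (1 / α) * G y ^ (s / α) by
        rw [ENNReal.coe_mul, ENNReal.coe_rpow_of_nonneg _ (by positivity)]
        simp only [ENNReal.coe_ofNat]
        ring]
    rw [ENNReal.mul_rpow_of_nonneg _ _ hα.le, ENNReal.mul_rpow_of_nonneg _ _ hα.le,
      ENNReal.coe_rpow_of_nonneg _ hα.le, ← ENNReal.rpow_mul, ← ENNReal.rpow_mul,
      div_mul_cancel₀ _ hα.ne', div_mul_cancel₀ _ hα.ne', ENNReal.rpow_one]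
  -- If G(y) = 0 then G(y)^(-s) = ∞, but the integral vanishes and 0 · ∞ = 0.
  rcases eq_or_ne (G y) 0 with h0 | h0
  · rw [h0, ENNReal.zero_rpow_of_pos hs, mul_zero] at h2
    rw [le_antisymm h2 zero_le, zero_mul]
    exact zero_le
  · calc _ ≤ ((C * 2 ^ (β / α)) ^ α : ℝ≥0) * A * G y ^ s * G y ^ (-s) := by gcongr
      _ = _ := by rw [mul_assoc, rpow_mul_rpow_neg h0 (h.ne_top y hy), mul_one]

/-- The bound on G^(β/(α+s)) leaves F^(s/(α+s) - 1), and its integral to the power α + s is F(y)^s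
up to a constant. -/
theorem exists_tail_div_le (hα : 0 < α) (hβ : 0 < β) (hs : 0 < s) :
    ∃ C : ℝ≥0, ∀ (μ : Measure ℝ) (G : ℝ → ℝ≥0∞) (x : ℝ) (b : EReal), TailSetting μ G x b →
      ∀ A, (∀ t ∈ ivl x b, μ (Set.Ioi t) ^ α * G t ^ β ≤ A) → ∀ y ∈ ivl x b,
        (∫⁻ t in Set.Ioi y, G t ^ (β / (α + s)) ∂μ) ^ (α + s) * μ (Set.Ioi y) ^ (-s) ≤ C * A := by
  have hαs : 0 < α + s := by linarith
  obtain ⟨C, hC⟩ := exists_setLIntegral_tail_rpow_le (div_pos hs hαs)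
  refine ⟨C ^ (α + s), fun μ G x b h A hA y hy => ?_⟩
  have := h.noAtoms
  rcases eq_or_ne (μ (Set.Ioi y)) 0 with h0 | h0
  · rw [setLIntegral_measure_zero _ _ h0, ENNReal.zero_rpow_of_pos hαs, zero_mul]
    exact zero_le
  set r := β / (α + s) with hr
  have hr0 : 0 ≤ r := by positivity
  have hrβ : r / β * (α + s) = 1 := by rw [hr]; field_simp
  have h1 : ∫⁻ t in Set.Ioi y, G t ^ r ∂μ
      ≤ A ^ (r / β) * (C * μ (Set.Ioi y) ^ (s / (α + s))) := by
    calc ∫⁻ t in Set.Ioi y, G t ^ r ∂μ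
        ≤ ∫⁻ t in Set.Ioi y, A ^ (r / β) * μ (Set.Ioi t) ^ (s / (α + s) - 1) ∂μ := by
          refine lintegral_mono_ae ?_
          filter_upwards [h.ae_mem hy, ae_restrict_of_ae h.ae_tail_ne_zero] with t ht ht0
          refine (rpow_le_of_mul_rpow_le hβ hr0 ht0 (h.tail_ne_top_of_mem ht.2)
            (hA t ht.2)).trans_eq ?_
          congr 2
          rw [hr]
          field_simp
          ring
      _ = A ^ (r / β) * ∫⁻ t in Set.Ioi y, μ (Set.Ioi t) ^ (s / (α + s) - 1) ∂μ :=
          lintegral_const_mul _ ((antitone_measure_Ioi μ).measurable.pow_const _)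
      _ ≤ _ := by
          gcongr
          exact hC μ y (h.tail_ne_top_of_mem hy)
  calc (∫⁻ t in Set.Ioi y, G t ^ r ∂μ) ^ (α + s) * μ (Set.Ioi y) ^ (-s)
      ≤ (A ^ (r / β) * (C * μ (Set.Ioi y) ^ (s / (α + s)))) ^ (α + s)
          * μ (Set.Ioi y) ^ (-s) := by gcongr
    _ = (C ^ (α + s) : ℝ≥0) * A * (μ (Set.Ioi y) ^ s * μ (Set.Ioi y) ^ (-s)) := by
        rw [ENNReal.mul_rpow_of_nonneg _ _ hαs.le, ENNReal.mul_rpow_of_nonneg _ _ hαs.le]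
        simp only [← ENNReal.rpow_mul]
        rw [hrβ, div_mul_cancel₀ _ hαs.ne', ENNReal.rpow_one, ENNReal.coe_rpow_of_nonneg _ hαs.le]
        ring
    _ = (C ^ (α + s) : ℝ≥0) * A := by
        rw [rpow_mul_rpow_neg h0 (h.tail_ne_top_of_mem hy), mul_one]

theorem le_tail_div (hα : 0 < α) (hβ : 0 < β) (hs : 0 < s) {μ : Measure ℝ} {G : ℝ → ℝ≥0∞} {x : ℝ}
    {b : EReal} (h : TailSetting μ G x b) {y : ℝ} (hy : y ∈ ivl x b) :
    μ (Set.Ioi y) ^ α * G y ^ β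
      ≤ (∫⁻ t in Set.Ioi y, G t ^ (β / (α + s)) ∂μ) ^ (α + s) * μ (Set.Ioi y) ^ (-s) := by
  have hαs : 0 < α + s := by linarith
  rcases eq_or_ne (μ (Set.Ioi y)) 0 with h0 | h0
  · simp [h0, hα]
  calc μ (Set.Ioi y) ^ α * G y ^ β
      = (G y ^ (β / (α + s)) * μ (Set.Ioi y)) ^ (α + s) * μ (Set.Ioi y) ^ (-s) := by
        rw [ENNReal.mul_rpow_of_nonneg _ _ hαs.le, ← ENNReal.rpow_mul, div_mul_cancel₀ _ hαs.ne',
          mul_assoc, ← ENNReal.rpow_add _ _ h0 (h.tail_ne_top_of_mem hy), add_neg_cancel_right,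
          mul_comm]
    _ ≤ _ := by
        gcongr
        exact const_mul_measure_le_setLIntegral measurableSet_Ioi fun t ht =>
          ENNReal.rpow_le_rpow (h.mono (le_of_lt ht)) (by positivity)

end bounds

/-! ### Estimates for `B8trunc`, `B9` and for quantities with a non-monotone K. -/

section bounds

variable {α β s : ℝ}

/-- The bound on G^(β/(α-s)) is a multiple of F^(-s/(α-s) - 1), whose integral to the left of y is
controlled by F(y)^(-s/(α-s)). -/
theorem exists_truncated_mul_le (hβ : 0 < β) (hs : 0 < s) (hsα : s < α) :
    ∃ C : ℝ≥0, ∀ (μ : Measure ℝ) (G : ℝ → ℝ≥0∞) (x : ℝ) (b : EReal), TailSetting μ G x b →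
      ∀ A, (∀ t ∈ ivl x b, μ (Set.Ioi t) ^ α * G t ^ β ≤ A) → ∀ y ∈ ivl x b,
        (∫⁻ t in Set.Ioo x y, G t ^ (β / (α - s)) ∂μ) ^ (α - s) * μ (Set.Ioi y) ^ s ≤ C * A := by
  have hαs : 0 < α - s := by linarith
  obtain ⟨C, hC⟩ := exists_setLIntegral_Iio_tail_rpow_le (div_pos hs hαs)
  refine ⟨C ^ (α - s), fun μ G x b h A hA y hy => ?_⟩
  have := h.noAtoms
  rcases eq_or_ne (μ (Set.Ioi y)) 0 with h0 | h0
  · rw [h0, ENNReal.zero_rpow_of_pos hs, mul_zero]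
    exact zero_le
  set r := β / (α - s) with hr
  have hr0 : 0 ≤ r := by positivity
  have hrβ : r / β * (α - s) = 1 := by rw [hr]; field_simp
  have h1 : ∫⁻ t in Set.Ioo x y, G t ^ r ∂μ
      ≤ A ^ (r / β) * (C * μ (Set.Ioi y) ^ (-(s / (α - s)))) := by
    calc ∫⁻ t in Set.Ioo x y, G t ^ r ∂μ
        ≤ ∫⁻ t in Set.Ioo x y, A ^ (r / β) * μ (Set.Ioi t) ^ (-(s / (α - s)) - 1) ∂μ := by
          refine setLIntegral_mono' measurableSet_Ioo fun t ht => ?_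
          have htb : t ∈ ivl x b :=
            ⟨EReal.coe_lt_coe_iff.2 ht.1, (EReal.coe_lt_coe_iff.2 ht.2).trans hy.2⟩
          refine (rpow_le_of_mul_rpow_le hβ hr0 (fun h => h0 ?_) (h.tail_ne_top_of_mem htb)
            (hA t htb)).trans_eq ?_
          · exact measure_mono_null (Set.Ioi_subset_Ioi ht.2.le) h
          · congr 2
            rw [hr]
            field_simp
            ring
      _ ≤ ∫⁻ t in Set.Iio y, A ^ (r / β) * μ (Set.Ioi t) ^ (-(s / (α - s)) - 1) ∂μ :=
          lintegral_mono_set fun t ht => ht.2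
      _ = A ^ (r / β) * ∫⁻ t in Set.Iio y, μ (Set.Ioi t) ^ (-(s / (α - s)) - 1) ∂μ :=
          lintegral_const_mul _ ((antitone_measure_Ioi μ).measurable.pow_const _)
      _ ≤ _ := by
          gcongr
          exact hC μ y h0
  calc (∫⁻ t in Set.Ioo x y, G t ^ r ∂μ) ^ (α - s) * μ (Set.Ioi y) ^ s
      ≤ (A ^ (r / β) * (C * μ (Set.Ioi y) ^ (-(s / (α - s))))) ^ (α - s)
          * μ (Set.Ioi y) ^ s := by gcongr
    _ = (C ^ (α - s) : ℝ≥0) * A * (μ (Set.Ioi y) ^ s * μ (Set.Ioi y) ^ (-s)) := by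
        rw [ENNReal.mul_rpow_of_nonneg _ _ hαs.le, ENNReal.mul_rpow_of_nonneg _ _ hαs.le]
        simp only [← ENNReal.rpow_mul]
        rw [hrβ, neg_mul, div_mul_cancel₀ _ hαs.ne', ENNReal.rpow_one,
          ENNReal.coe_rpow_of_nonneg _ hαs.le]
        ring
    _ = (C ^ (α - s) : ℝ≥0) * A := by
        rw [rpow_mul_rpow_neg h0 (h.tail_ne_top_of_mem hy), mul_one]

theorem coe_four_rpow (p : ℝ) : ((4 ^ p : ℝ≥0) : ℝ≥0∞) = 4 ^ p := by
  rw [ENNReal.coe_rpow_of_ne_zero (by norm_num)]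
  simp

theorem rpow_eq_four_rpow_mul (c : ℝ≥0∞) {p : ℝ} (hp : 0 ≤ p) :
    c ^ p = (4 ^ p : ℝ≥0) * (c / 4) ^ p := by
  rw [coe_four_rpow, ← ENNReal.mul_rpow_of_nonneg _ _ hp, ENNReal.mul_div_cancel] <;> norm_num

/-- The value at y ignores the mass beyond y, so the hypothesis is used at a splitting point z: (y,
z) feeds the integral, (z, b) feeds F(z), and each has mass at least F(y)/4. -/
theorem le_truncated_mul (hα : 0 < α) (hβ : 0 < β) (hs : 0 < s) (hsα : s < α) {μ : Measure ℝ}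
    {G : ℝ → ℝ≥0∞} {x : ℝ} {b : EReal} (h : TailSetting μ G x b) {B : ℝ≥0∞}
    (hB : ∀ z ∈ ivl x b,
      (∫⁻ t in Set.Ioo x z, G t ^ (β / (α - s)) ∂μ) ^ (α - s) * μ (Set.Ioi z) ^ s ≤ B)
    {y : ℝ} (hy : y ∈ ivl x b) :
    μ (Set.Ioi y) ^ α * G y ^ β ≤ (4 ^ α : ℝ≥0) * B := by
  have hαs : 0 < α - s := by linarith
  have := h.noAtoms
  rcases eq_or_ne (μ (Set.Ioi y)) 0 with h0 | h0
  · simp [h0, hα]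
  obtain ⟨z, hyz, hz1, hz2⟩ := exists_tail_split h0 (h.tail_ne_top_of_mem hy)
  set c := μ (Set.Ioi y)
  have hc4 : c / 4 ≠ 0 := (ENNReal.div_pos h0 (by norm_num)).ne'
  have hc4' : c / 4 ≠ ∞ := ENNReal.div_ne_top (h.tail_ne_top_of_mem hy) (by norm_num)
  have hxy : x < y := EReal.coe_lt_coe_iff.1 hy.1
  have hzb : z ∈ ivl x b := ⟨EReal.coe_lt_coe_iff.2 (hxy.trans hyz),
    h.lt_of_tail_ne_zero fun h0 => hc4 (le_antisymm (hz1.trans_eq h0) zero_le)⟩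
  rw [rpow_eq_four_rpow_mul c hα.le, mul_assoc]
  gcongr
  calc (c / 4) ^ α * G y ^ β = (G y ^ (β / (α - s)) * (c / 4)) ^ (α - s) * (c / 4) ^ s := by
        rw [ENNReal.mul_rpow_of_nonneg _ _ hαs.le, ← ENNReal.rpow_mul, div_mul_cancel₀ _ hαs.ne',
          mul_assoc, ← ENNReal.rpow_add _ _ hc4 hc4', sub_add_cancel, mul_comm]
    _ ≤ (∫⁻ t in Set.Ioo x z, G t ^ (β / (α - s)) ∂μ) ^ (α - s) * μ (Set.Ioi z) ^ s := by
        gcongr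
        calc G y ^ (β / (α - s)) * (c / 4) ≤ G y ^ (β / (α - s)) * μ (Set.Ioo y z) := by gcongr
          _ ≤ ∫⁻ t in Set.Ioo y z, G t ^ (β / (α - s)) ∂μ :=
              const_mul_measure_le_setLIntegral measurableSet_Ioo fun t ht =>
                ENNReal.rpow_le_rpow (h.mono ht.1.le) (by positivity)
          _ ≤ _ := lintegral_mono_set (Set.Ioo_subset_Ioo_left hxy.le)
    _ ≤ B := hB z hzb

/-- The outer power α - s is negative, so the integral must be bounded below. On (y, z), with z a
splitting point, F ≥ F(y)/4 bounds G above, hence its negative power below, and the interval has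
mass at least F(y)/4. -/
theorem tail_mul_le (hα : 0 < α) (hβ : 0 < β) (hs : 0 < s) (hαs : α < s) {μ : Measure ℝ}
    {G : ℝ → ℝ≥0∞} {x : ℝ} {b : EReal} (h : TailSetting μ G x b) {A : ℝ≥0∞}
    (hA : ∀ t ∈ ivl x b, μ (Set.Ioi t) ^ α * G t ^ β ≤ A) {y : ℝ} (hy : y ∈ ivl x b) :
    (∫⁻ t in Set.Ioi y, G t ^ (β / (α - s)) ∂μ) ^ (α - s) * μ (Set.Ioi y) ^ s
      ≤ (4 ^ s : ℝ≥0) * A := by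
  have hsα : 0 < s - α := by linarith
  have := h.noAtoms
  rcases eq_or_ne (μ (Set.Ioi y)) 0 with h0 | h0
  · simp [h0, hs]
  rcases eq_or_ne A ∞ with rfl | hAT
  · rw [ENNReal.mul_top]
    · exact le_top
    · rw [coe_four_rpow]
      simp
  obtain ⟨z, hyz, hz1, hz2⟩ := exists_tail_split h0 (h.tail_ne_top_of_mem hy)
  set c := μ (Set.Ioi y)
  have hc4 : c / 4 ≠ 0 := (ENNReal.div_pos h0 (by norm_num)).ne'
  have hc4' : c / 4 ≠ ∞ := ENNReal.div_ne_top (h.tail_ne_top_of_mem hy) (by norm_num)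
  have hxy : x < y := EReal.coe_lt_coe_iff.1 hy.1
  have hz0 : μ (Set.Ioi z) ≠ 0 := fun h0 => hc4 (le_antisymm (hz1.trans_eq h0) zero_le)
  have hzb := h.lt_of_tail_ne_zero hz0
  set r := β / (s - α) with hr
  have hr' : β / (α - s) = -r := by rw [hr, ← div_neg, neg_sub]
  have hrβ : r / β * (s - α) = 1 := by rw [hr]; field_simp
  -- The upper bound for G^r on (y, z), where the tail is at least c/4.
  set X := A ^ (r / β) * (c / 4) ^ (-(α * r / β)) with hX
  have hXT : X ≠ ∞ := ENNReal.mul_ne_top (ENNReal.rpow_ne_top_of_nonneg (by positivity) hAT)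
    (by rw [Ne, ENNReal.rpow_eq_top_iff]; simp [hc4, hc4'])
  have h1 : X⁻¹ * (c / 4) ≤ ∫⁻ t in Set.Ioi y, G t ^ (-r) ∂μ := by
    calc X⁻¹ * (c / 4) ≤ X⁻¹ * μ (Set.Ioo y z) := by gcongr
      _ ≤ ∫⁻ t in Set.Ioo y z, G t ^ (-r) ∂μ :=
          const_mul_measure_le_setLIntegral measurableSet_Ioo fun t ht => by
            have htb : t ∈ ivl x b := ⟨EReal.coe_lt_coe_iff.2 (hxy.trans ht.1),
              (EReal.coe_lt_coe_iff.2 ht.2).trans hzb⟩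
            have htz := antitone_measure_Ioi μ ht.2.le
            rw [ENNReal.rpow_neg]
            refine ENNReal.inv_le_inv.2 ((rpow_le_of_mul_rpow_le hβ (by positivity) (fun h0 => hz0
              (le_antisymm (htz.trans_eq h0) zero_le)) (h.tail_ne_top_of_mem htb)
              (hA t htb)).trans ?_)
            rw [hX]
            exact mul_le_mul' le_rfl
              (rpow_le_rpow_of_nonpos' (neg_nonpos.2 (by positivity)) (hz1.trans htz))
      _ ≤ _ := lintegral_mono_set Set.Ioo_subset_Ioi_self
  rw [hr', rpow_eq_four_rpow_mul c hs.le]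
  calc (∫⁻ t in Set.Ioi y, G t ^ (-r) ∂μ) ^ (α - s) * ((4 ^ s : ℝ≥0) * (c / 4) ^ s)
      ≤ (X⁻¹ * (c / 4)) ^ (α - s) * ((4 ^ s : ℝ≥0) * (c / 4) ^ s) := by
        gcongr ?_ * _
        exact rpow_le_rpow_of_nonpos' (by linarith) h1
    _ = (4 ^ s : ℝ≥0) * (A * ((c / 4) ^ (-α) * (c / 4) ^ (α - s) * (c / 4) ^ s)) := by
        rw [ENNReal.mul_rpow_of_ne_zero (ENNReal.inv_ne_zero.2 hXT) hc4, ENNReal.inv_rpow,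
          ← ENNReal.rpow_neg, neg_sub, hX, ENNReal.mul_rpow_of_nonneg _ _ hsα.le,
          ← ENNReal.rpow_mul, ← ENNReal.rpow_mul, hrβ, ENNReal.rpow_one,
          show -(α * r / β) * (s - α) = -α by rw [mul_div_assoc, neg_mul, mul_assoc, hrβ, mul_one]]
        ring
    _ = (4 ^ s : ℝ≥0) * A := by
        rw [← ENNReal.rpow_add _ _ hc4 hc4', ← ENNReal.rpow_add _ _ hc4 hc4',
          show -α + (α - s) + s = 0 by ring, ENNReal.rpow_zero, mul_one]

theorem le_tail_mul (hα : 0 < α) (hβ : 0 < β) (hαs : α < s) {μ : Measure ℝ}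
    {G : ℝ → ℝ≥0∞} {x : ℝ} {b : EReal} (h : TailSetting μ G x b) {y : ℝ} (hy : y ∈ ivl x b) :
    μ (Set.Ioi y) ^ α * G y ^ β
      ≤ (∫⁻ t in Set.Ioi y, G t ^ (β / (α - s)) ∂μ) ^ (α - s) * μ (Set.Ioi y) ^ s := by
  have hαs' : α - s < 0 := by linarith
  rcases eq_or_ne (μ (Set.Ioi y)) 0 with h0 | h0
  · simp [h0, hα]
  rcases eq_or_ne (G y) 0 with hG0 | hG0
  · simp [hG0, hβ]
  have hT := h.tail_ne_top_of_mem hy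
  have hGT := h.ne_top y hy
  calc μ (Set.Ioi y) ^ α * G y ^ β
      = (G y ^ (β / (α - s)) * μ (Set.Ioi y)) ^ (α - s) * μ (Set.Ioi y) ^ s := by
        rw [ENNReal.mul_rpow_of_ne_zero _ h0, ← ENNReal.rpow_mul, div_mul_cancel₀ _ hαs'.ne,
          mul_assoc, ← ENNReal.rpow_add _ _ h0 hT, sub_add_cancel, mul_comm]
        rw [Ne, ENNReal.rpow_eq_zero_iff]
        simp [hG0, hGT]
    _ ≤ _ := by
        gcongr ?_ * _
        refine rpow_le_rpow_of_nonpos' hαs'.le ?_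
        rw [← setLIntegral_const]
        exact setLIntegral_mono' measurableSet_Ioi fun t ht => rpow_le_rpow_of_nonpos'
          (div_nonpos_of_nonneg_of_nonpos hβ.le hαs'.le) (h.mono (le_of_lt ht))

/-- Undoes the density K^p; this is how μ is recovered from the auxiliary measure ν. -/
theorem setLIntegral_rpow_withDensity {μ : Measure ℝ} {K : ℝ → ℝ≥0∞} {S : Set ℝ}
    (hS : MeasurableSet S) (hK : AEMeasurable K μ) (p : ℝ)
    (hK0 : ∀ᵐ t ∂μ.restrict S, K t ≠ 0) (hKT : ∀ᵐ t ∂μ.restrict S, K t ≠ ∞) :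
    ∫⁻ t in S, K t ^ (-p) ∂μ.withDensity (fun t => K t ^ p) = μ S := by
  rw [restrict_withDensity hS, lintegral_withDensity_eq_lintegral_mul₀
    (hK.restrict.pow_const _) (hK.restrict.pow_const _), ← setLIntegral_one]
  refine lintegral_congr_ae ?_
  filter_upwards [hK0, hKT] with t h0 hT
  exact rpow_mul_rpow_neg h0 hT p

/-- With dν = K^p dμ, p = (β - s)/α, the hypothesis reads ν((z, ∞))^α K(z)^s ≤ B, the same shape as
the bound on F^α G^β. Hence K^(-p) is at most a multiple of ν((t, ∞))^(β/s - 1); integrating against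
ν bounds F(y) by ν((y, ∞))^(β/s). Monotonicity of G serves only to keep K positive to the right of
y. -/
theorem exists_le_tail_weighted (hα : 0 < α) (hβ : 0 < β) (hβs : β < s) :
    ∃ C : ℝ≥0, ∀ (μ : Measure ℝ) (G : ℝ → ℝ≥0∞) (x : ℝ) (b : EReal), TailSetting μ G x b →
      ∀ (K : ℝ → ℝ≥0∞) (B : ℝ≥0∞), AEMeasurable K μ → (∀ t ∈ ivl x b, K t ≠ ∞) →
        (∀ t, G t ≤ K t) →
        (∀ z ∈ ivl x b, (∫⁻ t in Set.Ioi z, K t ^ ((β - s) / α) ∂μ) ^ α * K z ^ s ≤ B) →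
        ∀ y ∈ ivl x b, μ (Set.Ioi y) ^ α * G y ^ β ≤ C * B := by
  have hs : 0 < s := hβ.trans hβs
  obtain ⟨C, hC⟩ := exists_setLIntegral_tail_rpow_le (div_pos hβ hs)
  -- The summand 1 keeps the constant nonzero, so that B = ∞ is trivial even if C = 0.
  refine ⟨C ^ α + 1, fun μ G x b h K B hK hKT hGK hB y hy => ?_⟩
  have := h.noAtoms
  rcases eq_or_ne (G y) 0 with hG0 | hG0
  · simp [hG0, hβ]
  rcases eq_or_ne B ∞ with rfl | hBT
  · simp
  set p := (β - s) / α with hp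
  have hp0 : 0 ≤ -p := by rw [hp, ← neg_div]; exact div_nonneg (by linarith) hα.le
  set ν := μ.withDensity fun t => K t ^ p with hν
  have hν_eq : ∀ z, ν (Set.Ioi z) = ∫⁻ t in Set.Ioi z, K t ^ p ∂μ := fun z =>
    withDensity_apply _ measurableSet_Ioi
  have hBν : ∀ z ∈ ivl x b, ν (Set.Ioi z) ^ α * K z ^ s ≤ B := fun z hz => by
    rw [hν_eq]
    exact hB z hz
  have hyT : ν (Set.Ioi y) ≠ ∞ := fun hT => by
    refine hBT (top_le_iff.1 ((hBν y hy).trans' ?_))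
    rw [hT, ENNReal.top_rpow_of_pos hα, ENNReal.top_mul]
    exact (ENNReal.rpow_pos ((pos_iff_ne_zero.2 hG0).trans_le (hGK y)) (hKT y hy)).ne'
  have hK0' : ∀ t, y ≤ t → K t ≠ 0 := fun t ht h0 =>
    hG0 (le_antisymm (((h.mono ht).trans (hGK t)).trans_eq h0) zero_le)
  have hν0 : ∀ᵐ t ∂ν, ν (Set.Ioi t) ≠ 0 := by
    have h0 : ν {t | ν (Set.Ioi t) ≤ 0} = 0 := le_antisymm (measure_Ioi_le_le 0) zero_le
    filter_upwards [measure_eq_zero_iff_ae_notMem.1 h0] with t ht h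
    exact ht h.le
  have hμν : ∀ᵐ t ∂ν.restrict (Set.Ioi y), y < t ∧ t ∈ ivl x b :=
    ((withDensity_absolutelyContinuous μ _).restrict _).ae_le (h.ae_mem hy)
  have hps : -p / s * α = (s - β) / s := by rw [hp]; field_simp; ring
  have h1 : μ (Set.Ioi y) ≤ B ^ (-p / s) * (C * ν (Set.Ioi y) ^ (β / s)) := by
    calc μ (Set.Ioi y) = ∫⁻ t in Set.Ioi y, K t ^ (-p) ∂ν := by
          rw [hν, setLIntegral_rpow_withDensity measurableSet_Ioi hK p]
          · filter_upwards [h.ae_mem hy] with t ht using hK0' t ht.1.le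
          · filter_upwards [h.ae_mem hy] with t ht using hKT t ht.2
      _ ≤ ∫⁻ t in Set.Ioi y, B ^ (-p / s) * ν (Set.Ioi t) ^ (β / s - 1) ∂ν := by
          refine lintegral_mono_ae ?_
          filter_upwards [hμν, ae_restrict_of_ae hν0] with t ht ht0
          refine (rpow_le_of_mul_rpow_le hs hp0 ht0
            ((antitone_measure_Ioi ν ht.1.le).trans_lt hyT.lt_top).ne (hBν t ht.2)).trans_eq ?_
          congr 2
          rw [mul_div_assoc, mul_comm, hps]
          field_simp
          ring
      _ = B ^ (-p / s) * ∫⁻ t in Set.Ioi y, ν (Set.Ioi t) ^ (β / s - 1) ∂ν :=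
          lintegral_const_mul _ ((antitone_measure_Ioi ν).measurable.pow_const _)
      _ ≤ _ := by
          gcongr
          exact hC ν y hyT
  calc μ (Set.Ioi y) ^ α * G y ^ β
      ≤ (B ^ (-p / s) * (C * ν (Set.Ioi y) ^ (β / s))) ^ α * K y ^ β := by
        have := hGK y
        gcongr
    _ = C ^ α * (B ^ ((s - β) / s) * (ν (Set.Ioi y) ^ α * K y ^ s) ^ (β / s)) := by
        rw [ENNReal.mul_rpow_of_nonneg _ _ hα.le, ENNReal.mul_rpow_of_nonneg _ _ hα.le,
          ENNReal.mul_rpow_of_nonneg _ _ (by positivity : 0 ≤ β / s)]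
        simp only [← ENNReal.rpow_mul]
        rw [hps, mul_comm (β / s) α, mul_div_cancel₀ _ hs.ne']
        ring
    _ ≤ C ^ α * (B ^ ((s - β) / s) * B ^ (β / s)) := by
        gcongr
        exact hBν y hy
    _ = (C ^ α : ℝ≥0) * B := by
        rw [← ENNReal.rpow_add_of_nonneg _ _ (div_nonneg (by linarith) hs.le) (by positivity),
          ← add_div, sub_add_cancel, div_self hs.ne', ENNReal.rpow_one,
          ENNReal.coe_rpow_of_nonneg _ hα.le]
    _ ≤ (C ^ α + 1 : ℝ≥0) * B := by
        gcongr
        exact le_self_add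

/-- With dν = K^q dμ on (x, ∞), q = (β + s)/α, the hypothesis bounds K^(-q) by a multiple of ν(Iio
t)^(-β/s - 1). Integrating over (z, ∞) bounds F(z) by ν(Iio z)^(-β/s), while ν(Iio z) ≥ G(y)^q
F(y)/4. With z a splitting point, F(z) ≥ F(y)/4, and the two combine into a bound on F(y) and G(y)
alone. -/
theorem exists_le_truncated_weighted (hα : 0 < α) (hβ : 0 < β) (hs : 0 < s) :
    ∃ C : ℝ≥0, ∀ (μ : Measure ℝ) (G : ℝ → ℝ≥0∞) (x : ℝ) (b : EReal), TailSetting μ G x b →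
      ∀ (K : ℝ → ℝ≥0∞) (B : ℝ≥0∞), AEMeasurable K μ → (∀ t ∈ ivl x b, K t ≠ ∞) →
        (∀ t, G t ≤ K t) →
        (∀ z ∈ ivl x b, (∫⁻ t in Set.Ioo x z, K t ^ ((β + s) / α) ∂μ) ^ α * K z ^ (-s) ≤ B) →
        ∀ y ∈ ivl x b, μ (Set.Ioi y) ^ α * G y ^ β ≤ C * B := by
  obtain ⟨C, hC⟩ := exists_setLIntegral_Ioi_head_rpow_le (div_pos hβ hs)
  set q := (β + s) / α with hq
  have hq0 : 0 < q := by positivity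
  have hqs : α * (q / s) = β / s + 1 := by rw [hq]; field_simp
  refine ⟨4 ^ α * (C ^ (s / q) + 1), fun μ G x b h K B hK hKT hGK hB y hy => ?_⟩
  have := h.noAtoms
  rcases eq_or_ne (G y) 0 with hG0 | hG0
  · simp [hG0, hβ]
  rcases eq_or_ne (μ (Set.Ioi y)) 0 with h0 | h0
  · simp [h0, hα]
  rcases eq_or_ne B ∞ with rfl | hBT
  · rw [ENNReal.mul_top]
    · exact le_top
    · rw [ENNReal.coe_mul, coe_four_rpow]
      simp
  obtain ⟨z, hyz, hz1, hz2⟩ := exists_tail_split h0 (h.tail_ne_top_of_mem hy)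
  set c := μ (Set.Ioi y)
  have hc4 : c / 4 ≠ 0 := (ENNReal.div_pos h0 (by norm_num)).ne'
  have hc4' : c / 4 ≠ ∞ := ENNReal.div_ne_top (h.tail_ne_top_of_mem hy) (by norm_num)
  have hxy : x < y := EReal.coe_lt_coe_iff.1 hy.1
  have hzb : z ∈ ivl x b := ⟨EReal.coe_lt_coe_iff.2 (hxy.trans hyz),
    h.lt_of_tail_ne_zero fun h0 => hc4 (le_antisymm (hz1.trans_eq h0) zero_le)⟩
  have hK0 : ∀ t, y ≤ t → K t ≠ 0 := fun t ht h0 =>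
    hG0 (le_antisymm (((h.mono ht).trans (hGK t)).trans_eq h0) zero_le)
  have hK' : AEMeasurable K (μ.restrict (Set.Ioi x)) := hK.restrict
  set ν := (μ.restrict (Set.Ioi x)).withDensity fun t => K t ^ q with hν
  have hν_eq : ∀ t, ν (Set.Iio t) = ∫⁻ r in Set.Ioo x t, K r ^ q ∂μ := fun t => by
    rw [hν, withDensity_apply _ measurableSet_Iio, Measure.restrict_restrict measurableSet_Iio,
      Set.inter_comm, Set.Ioi_inter_Iio]
  have hBν : ∀ t ∈ ivl x b, ν (Set.Iio t) ^ α * (K t)⁻¹ ^ s ≤ B := fun t ht => by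
    rw [hν_eq, ENNReal.inv_rpow, ← ENNReal.rpow_neg]
    exact hB t ht
  have hz3 : G y ^ q * (c / 4) ≤ ν (Set.Iio z) := by
    rw [hν_eq]
    calc G y ^ q * (c / 4) ≤ G y ^ q * μ (Set.Ioo y z) := by gcongr
      _ ≤ ∫⁻ t in Set.Ioo y z, K t ^ q ∂μ :=
          const_mul_measure_le_setLIntegral measurableSet_Ioo fun t ht =>
            ENNReal.rpow_le_rpow ((h.mono ht.1.le).trans (hGK t)) hq0.le
      _ ≤ _ := lintegral_mono_set (Set.Ioo_subset_Ioo_left hxy.le)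
  have hGq0 : G y ^ q ≠ 0 := (ENNReal.rpow_pos (pos_iff_ne_zero.2 hG0) (h.ne_top y hy)).ne'
  have hGqT : G y ^ q ≠ ∞ := ENNReal.rpow_ne_top_of_nonneg hq0.le (h.ne_top y hy)
  have hνz : ν (Set.Iio z) ≠ 0 := ((pos_iff_ne_zero.2 (mul_ne_zero hGq0 hc4)).trans_le hz3).ne'
  have hνT : ∀ t ∈ ivl x b, ν (Set.Iio t) ≠ ∞ := fun t ht hT => by
    refine hBT (top_le_iff.1 ((hBν t ht).trans' ?_))
    rw [hT, ENNReal.top_rpow_of_pos hα, ENNReal.top_mul]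
    rw [ENNReal.inv_rpow]
    exact ENNReal.inv_ne_zero.2 (ENNReal.rpow_ne_top_of_nonneg hs.le (hKT t ht))
  have hres : (μ.restrict (Set.Ioi x)).restrict (Set.Ioi z) = μ.restrict (Set.Ioi z) := by
    rw [Measure.restrict_restrict measurableSet_Ioi,
      Set.inter_eq_left.2 (Set.Ioi_subset_Ioi (hxy.trans hyz).le)]
  have hμν : ∀ᵐ t ∂ν.restrict (Set.Ioi z), z < t ∧ t ∈ ivl x b := by
    refine ((withDensity_absolutelyContinuous _ _).restrict _).ae_le ?_
    rw [hres]
    exact h.ae_mem hzb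
  have h1 : c / 4 ≤ B ^ (q / s) * (C * (G y ^ q * (c / 4)) ^ (-(β / s))) := by
    calc c / 4 ≤ μ (Set.Ioi z) := hz1
      _ = ∫⁻ t in Set.Ioi z, K t ^ (-q) ∂ν := by
          rw [hν, setLIntegral_rpow_withDensity measurableSet_Ioi hK' q]
          · rw [Measure.restrict_apply measurableSet_Ioi,
              Set.inter_eq_left.2 (Set.Ioi_subset_Ioi (hxy.trans hyz).le)]
          · rw [hres]
            filter_upwards [h.ae_mem hzb] with t ht using hK0 t (hyz.trans ht.1).le
          · rw [hres]
            filter_upwards [h.ae_mem hzb] with t ht using hKT t ht.2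
      _ ≤ ∫⁻ t in Set.Ioi z, B ^ (q / s) * ν (Set.Iio t) ^ (-(β / s) - 1) ∂ν := by
          refine lintegral_mono_ae ?_
          filter_upwards [hμν] with t ht
          rw [ENNReal.rpow_neg, ← ENNReal.inv_rpow]
          refine (rpow_le_of_mul_rpow_le hs hq0.le ((pos_iff_ne_zero.2 hνz).trans_le
            (monotone_measure_Iio ν ht.1.le)).ne' (hνT t ht.2) (hBν t ht.2)).trans_eq ?_
          rw [mul_div_assoc, hqs, neg_add']
      _ = B ^ (q / s) * ∫⁻ t in Set.Ioi z, ν (Set.Iio t) ^ (-(β / s) - 1) ∂ν :=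
          lintegral_const_mul _ ((monotone_measure_Iio ν).measurable.pow_const _)
      _ ≤ B ^ (q / s) * (C * ν (Set.Iio z) ^ (-(β / s))) := by
          gcongr
          exact hC ν z hνz
      _ ≤ _ := by
          gcongr _ * (_ * ?_)
          exact rpow_le_rpow_of_nonpos' (neg_nonpos.2 (by positivity)) hz3
  have h2 : (c / 4) ^ (β / s + 1) * G y ^ (q * (β / s)) ≤ C * B ^ (q / s) := by
    rw [ENNReal.mul_rpow_of_ne_zero hGq0 hc4] at h1
    calc (c / 4) ^ (β / s + 1) * G y ^ (q * (β / s))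
        = (c / 4) * ((c / 4) ^ (β / s) * (G y ^ q) ^ (β / s)) := by
          rw [ENNReal.rpow_add _ _ hc4 hc4', ENNReal.rpow_one, ENNReal.rpow_mul]
          ring
      _ ≤ B ^ (q / s) * (C * ((G y ^ q) ^ (-(β / s)) * (c / 4) ^ (-(β / s))))
          * ((c / 4) ^ (β / s) * (G y ^ q) ^ (β / s)) := by gcongr
      _ = C * B ^ (q / s) * ((c / 4) ^ (β / s) * (c / 4) ^ (-(β / s)))
          * ((G y ^ q) ^ (β / s) * (G y ^ q) ^ (-(β / s))) := by ring
      _ = C * B ^ (q / s) := by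
          rw [rpow_mul_rpow_neg hc4 hc4', rpow_mul_rpow_neg hGq0 hGqT, mul_one, mul_one]
  -- Since β/s + 1 = αq/s, the power s/q turns the exponents of c/4, G(y) and B into α, β and 1.
  have hsq : (0 : ℝ) ≤ s / q := by positivity
  have h3 : (c / 4) ^ α * G y ^ β ≤ C ^ (s / q) * B := by
    have h4 := ENNReal.rpow_le_rpow h2 hsq
    rw [ENNReal.mul_rpow_of_nonneg _ _ hsq, ENNReal.mul_rpow_of_nonneg _ _ hsq] at h4
    simp only [← ENNReal.rpow_mul] at h4
    rw [← hqs] at h4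
    rwa [show α * (q / s) * (s / q) = α by field_simp,
      show q * (β / s) * (s / q) = β by field_simp,
      show q / s * (s / q) = 1 by field_simp, ENNReal.rpow_one] at h4
  rw [rpow_eq_four_rpow_mul c hα.le, ENNReal.coe_mul, mul_assoc, mul_assoc]
  refine mul_le_mul' le_rfl (h3.trans ?_)
  rw [← ENNReal.coe_rpow_of_nonneg _ hsq]
  gcongr
  exact le_self_add

end bounds

/-! ### From weights to measures. -/

theorem measurableSet_ivl (c d : EReal) : MeasurableSet (ivl c d) :=
  (measurableSet_lt measurable_const measurable_coe_real_ereal).inter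
    (measurableSet_lt measurable_coe_real_ereal measurable_const)

/-- The measure `f dt` on `(a, b)`. -/
noncomputable def weightMeasure (a b : EReal) (f : ℝ → ℝ≥0) : Measure ℝ :=
  (volume.restrict (ivl a b)).withDensity fun t => f t

/-- The standing assumptions on the weights `f`, `g` and the point `x`. -/
structure Admissible (a b : EReal) (f g : ℝ → ℝ≥0) (x : ℝ) : Prop where
  left : IsWeight a b f
  right : IsWeight a b g
  tail_lt_top : ∀ y ∈ ivl a b, tailInt b f y < ∞
  head_lt_top : ∀ y ∈ ivl a b, headInt a g y < ∞
  mem : x ∈ ivl a b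

section weights

variable {a b : EReal} {f g : ℝ → ℝ≥0} {x : ℝ}

/-- The density is finite everywhere, so φ need not be measurable. -/
theorem setLIntegral_weightMeasure (hf : IsWeight a b f) {S : Set ℝ} (hS : MeasurableSet S)
    (φ : ℝ → ℝ≥0∞) :
    ∫⁻ t in S, φ t ∂weightMeasure a b f = ∫⁻ t in S ∩ ivl a b, f t * φ t := by
  rw [weightMeasure, restrict_withDensity hS, Measure.restrict_restrict hS,
    lintegral_withDensity_eq_lintegral_mul_non_measurable₀]
  · rfl
  · exact (hf.mono_measure (Measure.restrict_mono Set.inter_subset_right le_rfl)).coe_nnreal_ennreal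
  · exact Filter.Eventually.of_forall fun t => ENNReal.coe_lt_top

theorem Ioi_inter_ivl {y : ℝ} (hy : a < y) : Set.Ioi y ∩ ivl a b = ivl y b := by
  ext t
  exact ⟨fun h => ⟨EReal.coe_lt_coe_iff.2 h.1, h.2.2⟩,
    fun h => ⟨EReal.coe_lt_coe_iff.1 h.1, hy.trans h.1, h.2⟩⟩

theorem Ioo_inter_ivl {y z : ℝ} (hy : a < y) (hz : z < b) : Set.Ioo y z ∩ ivl a b = ivl y z := by
  ext t
  exact ⟨fun h => ⟨EReal.coe_lt_coe_iff.2 h.1.1, EReal.coe_lt_coe_iff.2 h.1.2⟩,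
    fun h => ⟨⟨EReal.coe_lt_coe_iff.1 h.1, EReal.coe_lt_coe_iff.1 h.2⟩, hy.trans h.1,
      h.2.trans hz⟩⟩

theorem wInt_eq_tail (hf : IsWeight a b f) {y : ℝ} (hy : a < y) (W : ℝ → ℝ≥0∞) (p : ℝ) :
    wInt y b f W p = ∫⁻ t in Set.Ioi y, W t ^ p ∂weightMeasure a b f := by
  rw [setLIntegral_weightMeasure hf measurableSet_Ioi, Ioi_inter_ivl hy, wInt]

theorem wInt_eq_truncated (hf : IsWeight a b f) {y z : ℝ} (hy : a < y) (hz : z < b)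
    (W : ℝ → ℝ≥0∞) (p : ℝ) :
    wInt y z f W p = ∫⁻ t in Set.Ioo y z, W t ^ p ∂weightMeasure a b f := by
  rw [setLIntegral_weightMeasure hf measurableSet_Ioo, Ioo_inter_ivl hy hz, wInt]

theorem tailInt_eq (hf : IsWeight a b f) {y : ℝ} (hy : a < y) :
    tailInt b f y = weightMeasure a b f (Set.Ioi y) := by
  rw [← setLIntegral_one, setLIntegral_weightMeasure hf measurableSet_Ioi, Ioi_inter_ivl hy]
  simp [tailInt]

theorem monotone_headInt (a : EReal) (g : ℝ → ℝ≥0) : Monotone (headInt a g) := fun _ _ h =>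
  lintegral_mono_set fun _ ht => ⟨ht.1, ht.2.trans_le (EReal.coe_le_coe_iff.2 h)⟩

namespace Admissible

theorem mem_of_mem (h : Admissible a b f g x) {y : ℝ} (hy : y ∈ ivl x b) : y ∈ ivl a b := ⟨h.mem.1.trans hy.1, hy.2⟩

theorem tailSetting (h : Admissible a b f g x) :
    TailSetting (weightMeasure a b f) (headInt a g) x b where
  noAtoms := by
    unfold weightMeasure
    infer_instance
  mono := monotone_headInt a g
  ae_lt := (withDensity_absolutelyContinuous _ _).ae_le <| by
    filter_upwards [ae_restrict_mem (measurableSet_ivl a b)] with t ht using ht.2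
  tail_ne_top := by
    rw [← tailInt_eq h.left h.mem.1]
    exact (h.tail_lt_top x h.mem).ne
  ne_top := fun t ht => (h.head_lt_top t (h.mem_of_mem ht)).ne

end Admissible

end weights

/-! ### Uniform comparison of functionals. -/

/-- A quantity depending on `a`, `b`, `f`, `g` and `x`. -/
abbrev Functional := EReal → EReal → (ℝ → ℝ≥0) → (ℝ → ℝ≥0) → ℝ → ℝ≥0∞

/-- `L` is bounded by a constant multiple of `R`, uniformly in all admissible data. -/
def UniformLE (L R : Functional) : Prop :=
  ∃ C : ℝ≥0, ∀ a b f g x, Admissible a b f g x → L a b f g x ≤ C * R a b f g x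

/-- `L` and `R` are equivalent, uniformly in all admissible data. -/
def UniformEquiv (L R : Functional) : Prop :=
  ∃ C : ℝ≥0, ∀ a b f g x, Admissible a b f g x → EquivWith C (L a b f g x) (R a b f g x)

theorem UniformLE.trans {L M R : Functional} (h₁ : UniformLE L M) (h₂ : UniformLE M R) :
    UniformLE L R := by
  obtain ⟨C, hC⟩ := h₁
  obtain ⟨D, hD⟩ := h₂
  refine ⟨C * D, fun a b f g x h => (hC a b f g x h).trans ?_⟩
  rw [ENNReal.coe_mul, mul_assoc]
  exact mul_le_mul' le_rfl (hD a b f g x h)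

theorem EquivWith.mono {C D : ℝ≥0} (hCD : C ≤ D) {A B : ℝ≥0∞} (h : EquivWith C A B) :
    EquivWith D A B :=
  ⟨h.1.trans (by gcongr), h.2.trans (by gcongr)⟩

theorem UniformLE.equiv {L R : Functional} (h₁ : UniformLE L R) (h₂ : UniformLE R L) :
    UniformEquiv L R := by
  obtain ⟨C, hC⟩ := h₁
  obtain ⟨D, hD⟩ := h₂
  refine ⟨max C D, fun a b f g x h => ⟨(hC a b f g x h).trans ?_, (hD a b f g x h).trans ?_⟩⟩
  · gcongr
    exact le_max_left _ _
  · gcongr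
    exact le_max_right _ _

theorem le_supOn {c d : EReal} (B : ℝ → ℝ≥0∞) {y : ℝ} (hy : y ∈ ivl c d) : B y ≤ supOn c d B :=
  le_iSup₂ (f := fun y _ => B y) y hy

theorem supOn_le_mul_supOn {c d : EReal} {B B' : ℝ → ℝ≥0∞} {C : ℝ≥0∞}
    (h : ∀ y ∈ ivl c d, B y ≤ C * B' y) : supOn c d B ≤ C * supOn c d B' :=
  iSup₂_le fun y hy => (h y hy).trans (mul_le_mul' le_rfl (le_supOn B' hy))

/-! ### The equivalences on (x, b). -/

section equivalences

variable {α β s : ℝ}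

theorem B1_eq {a b : EReal} {f g : ℝ → ℝ≥0} {x : ℝ} (h : Admissible a b f g x) {y : ℝ}
    (hy : y ∈ ivl x b) :
    B1 a b f g α β y = weightMeasure a b f (Set.Ioi y) ^ α * headInt a g y ^ β := by
  rw [B1, tailInt_eq h.left (h.mem_of_mem hy).1]

/-- The bound on `B1` in the form used by the estimates for `TailSetting`. -/
theorem Admissible.le_supOn_B1 {a b : EReal} {f g : ℝ → ℝ≥0} {x : ℝ} (h : Admissible a b f g x) :
    ∀ t ∈ ivl x b, weightMeasure a b f (Set.Ioi t) ^ α * headInt a g t ^ β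
      ≤ supOn x b (B1 a b f g α β) := fun t ht => by
  rw [← B1_eq h ht]
  exact le_supOn _ ht

theorem B2_le_B1 (hα : 0 < α) (hβ : 0 < β) (hs : 0 < s) :
    UniformLE (fun a b f g x => supOn x b (B2 a b f g α β s))
      (fun a b f g x => supOn x b (B1 a b f g α β)) := by
  obtain ⟨C, hC⟩ := exists_tail_weighted_le hα hβ hs
  refine ⟨C, fun a b f g x h => iSup₂_le fun y hy => ?_⟩
  rw [B2, wInt_eq_tail h.left (h.mem_of_mem hy).1]
  exact hC _ _ _ _ h.tailSetting _ h.le_supOn_B1 y hy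

theorem B4trunc_le_B1 (hα : 0 < α) (hβ : 0 < β) (hs : 0 < s) :
    UniformLE (fun a b f g x => supOn x b (B4trunc a f g α β s x))
      (fun a b f g x => supOn x b (B1 a b f g α β)) := by
  obtain ⟨C, hC⟩ := exists_truncated_weighted_le hα hβ hs
  refine ⟨C, fun a b f g x h => iSup₂_le fun y hy => ?_⟩
  rw [B4trunc, wInt_eq_truncated h.left h.mem.1 hy.2]
  exact hC _ _ _ _ h.tailSetting _ h.le_supOn_B1 y hy

theorem B6_equiv_B1 (hα : 0 < α) (hβ : 0 < β) (hs : 0 < s) :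
    UniformEquiv (fun a b f g x => supOn x b (B1 a b f g α β))
      (fun a b f g x => supOn x b (B6 a b f g α β s)) := by
  have key : ∀ {a b f g x y}, Admissible a b f g x → y ∈ ivl x b → B6 a b f g α β s y
      = (∫⁻ t in Set.Ioi y, headInt a g t ^ (β / (α + s)) ∂weightMeasure a b f) ^ (α + s)
        * weightMeasure a b f (Set.Ioi y) ^ (-s) := fun h hy => by
    rw [B6, wInt_eq_tail h.left (h.mem_of_mem hy).1, tailInt_eq h.left (h.mem_of_mem hy).1]
  refine UniformLE.equiv ⟨1, fun a b f g x h => supOn_le_mul_supOn fun y hy => ?_⟩ ?_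
  · rw [B1_eq h hy, key h hy, ENNReal.coe_one, one_mul]
    exact le_tail_div hα hβ hs h.tailSetting hy
  · obtain ⟨C, hC⟩ := exists_tail_div_le hα hβ hs
    refine ⟨C, fun a b f g x h => iSup₂_le fun y hy => ?_⟩
    rw [key h hy]
    exact hC _ _ _ _ h.tailSetting _ h.le_supOn_B1 y hy

theorem B8trunc_equiv_B1 (hα : 0 < α) (hβ : 0 < β) (hs : 0 < s) (hsα : s < α) :
    UniformEquiv (fun a b f g x => supOn x b (B1 a b f g α β))
      (fun a b f g x => supOn x b (B8trunc a b f g α β s x)) := by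
  have key : ∀ {a b f g x y}, Admissible a b f g x → y ∈ ivl x b → B8trunc a b f g α β s x y
      = (∫⁻ t in Set.Ioo x y, headInt a g t ^ (β / (α - s)) ∂weightMeasure a b f) ^ (α - s)
        * weightMeasure a b f (Set.Ioi y) ^ s := fun h hy => by
    rw [B8trunc, wInt_eq_truncated h.left h.mem.1 hy.2, tailInt_eq h.left (h.mem_of_mem hy).1]
  refine UniformLE.equiv ⟨4 ^ α, fun a b f g x h => iSup₂_le fun y hy => ?_⟩ ?_
  · rw [B1_eq h hy]
    refine le_truncated_mul hα hβ hs hsα h.tailSetting (fun z hz => ?_) hy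
    rw [← key h hz]
    exact le_supOn _ hz
  · obtain ⟨C, hC⟩ := exists_truncated_mul_le hβ hs hsα
    refine ⟨C, fun a b f g x h => iSup₂_le fun y hy => ?_⟩
    rw [key h hy]
    exact hC _ _ _ _ h.tailSetting _ h.le_supOn_B1 y hy

theorem B9_equiv_B1 (hα : 0 < α) (hβ : 0 < β) (hs : 0 < s) (hαs : α < s) :
    UniformEquiv (fun a b f g x => supOn x b (B1 a b f g α β))
      (fun a b f g x => supOn x b (B9 a b f g α β s)) := by
  have key : ∀ {a b f g x y}, Admissible a b f g x → y ∈ ivl x b → B9 a b f g α β s y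
      = (∫⁻ t in Set.Ioi y, headInt a g t ^ (β / (α - s)) ∂weightMeasure a b f) ^ (α - s)
        * weightMeasure a b f (Set.Ioi y) ^ s := fun h hy => by
    rw [B9, wInt_eq_tail h.left (h.mem_of_mem hy).1, tailInt_eq h.left (h.mem_of_mem hy).1]
  refine UniformLE.equiv ⟨1, fun a b f g x h => supOn_le_mul_supOn fun y hy => ?_⟩
    ⟨4 ^ s, fun a b f g x h => iSup₂_le fun y hy => ?_⟩
  · rw [B1_eq h hy, key h hy, ENNReal.coe_one, one_mul]
    exact le_tail_mul hα hβ hαs h.tailSetting hy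
  · rw [key h hy]
    exact tail_mul_le hα hβ hs hαs h.tailSetting h.le_supOn_B1 hy

theorem aemeasurable_add_headInt {a b : EReal} {f g h : ℝ → ℝ≥0} (hh : IsWeight a b h) :
    AEMeasurable (fun t => (h t : ℝ≥0∞) + headInt a g t) (weightMeasure a b f) :=
  (hh.coe_nnreal_ennreal.mono_ac (withDensity_absolutelyContinuous _ _)).add
    (monotone_headInt a g).measurable.aemeasurable

/-- Enlarging C to C + 1 makes the constant invertible, so it can be moved across the infimum. -/
theorem le_mul_infWeights {a b : EReal} {Φ : (ℝ → ℝ≥0) → ℝ≥0∞} {A : ℝ≥0∞} {C : ℝ≥0}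
    (h : ∀ k, IsWeight a b k → A ≤ C * Φ k) : A ≤ (C + 1 : ℝ≥0) * infWeights a b Φ := by
  have hC0 : ((C + 1 : ℝ≥0) : ℝ≥0∞) ≠ 0 := by simp
  rw [← ENNReal.inv_mul_le_iff hC0 ENNReal.coe_ne_top]
  refine le_iInf₂ fun k hk => ?_
  rw [ENNReal.inv_mul_le_iff hC0 ENNReal.coe_ne_top]
  refine (h k hk).trans ?_
  gcongr
  exact le_self_add

theorem infWeights_le {a b : EReal} {Φ : (ℝ → ℝ≥0) → ℝ≥0∞} {k : ℝ → ℝ≥0} (hk : IsWeight a b k) :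
    infWeights a b Φ ≤ Φ k :=
  iInf₂_le (f := fun k _ => Φ k) k hk

theorem B1_le_inf_B12 (hα : 0 < α) (hβ : 0 < β) (hβs : β < s) :
    UniformLE (fun a b f g x => supOn x b (B1 a b f g α β))
      (fun a b f g x => infWeights a b fun k => supOn x b (B12 a b f g α β s k)) := by
  obtain ⟨C, hC⟩ := exists_le_tail_weighted hα hβ hβs
  refine ⟨C + 1, fun a b f g x h => le_mul_infWeights fun k hk => iSup₂_le fun y hy => ?_⟩
  rw [B1_eq h hy]
  refine hC _ _ _ _ h.tailSetting (fun t => (k t : ℝ≥0∞) + headInt a g t) _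
    (aemeasurable_add_headInt hk)
    (fun t ht => ENNReal.add_ne_top.2 ⟨ENNReal.coe_ne_top, h.tailSetting.ne_top t ht⟩)
    (fun t => le_add_self) (fun z hz => le_trans ?_ (le_supOn _ hz)) y hy
  rw [B12, wInt_eq_tail h.left (h.mem_of_mem hz).1]
  gcongr (?_ ^ _) * _
  -- The exponent (β - s)/α is nonpositive, so replacing h by h + G only lowers the integral.
  exact lintegral_mono fun t => rpow_le_rpow_of_nonpos'
    (div_nonpos_of_nonpos_of_nonneg (by linarith) hα.le) le_self_add

theorem B1_le_inf_B14trunc (hα : 0 < α) (hβ : 0 < β) (hs : 0 < s) :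
    UniformLE (fun a b f g x => supOn x b (B1 a b f g α β))
      (fun a b f g x => infWeights a b fun k => supOn x b (B14trunc a f g α β s k x)) := by
  obtain ⟨C, hC⟩ := exists_le_truncated_weighted hα hβ hs
  refine ⟨C + 1, fun a b f g x h => le_mul_infWeights fun k hk => iSup₂_le fun y hy => ?_⟩
  rw [B1_eq h hy]
  refine hC _ _ _ _ h.tailSetting (fun t => (k t : ℝ≥0∞) + headInt a g t) _
    (aemeasurable_add_headInt hk)
    (fun t ht => ENNReal.add_ne_top.2 ⟨ENNReal.coe_ne_top, h.tailSetting.ne_top t ht⟩)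
    (fun t => le_add_self) (fun z hz => le_trans ?_ (le_supOn _ hz)) y hy
  rw [B14trunc, wInt_eq_truncated h.left h.mem.1 hz.2]
  exact mul_le_mul' le_rfl (rpow_le_rpow_of_nonpos' (by linarith) le_self_add)

theorem isWeight_toNNReal_headInt (a b a' : EReal) (g : ℝ → ℝ≥0) :
    IsWeight a b fun t => (headInt a' g t).toNNReal :=
  (monotone_headInt a' g).measurable.ennreal_toNNReal.aemeasurable

theorem wInt_congr {c d : EReal} {f : ℝ → ℝ≥0} {W W' : ℝ → ℝ≥0∞} {p : ℝ}
    (h : ∀ t ∈ ivl c d, W t = W' t) : wInt c d f W p = wInt c d f W' p :=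
  setLIntegral_congr_fun (measurableSet_ivl c d) fun t ht => by
    show (f t : ℝ≥0∞) * W t ^ p = f t * W' t ^ p
    rw [h t ht]

theorem coe_two_rpow (p : ℝ) : ((2 ^ p : ℝ≥0) : ℝ≥0∞) = 2 ^ p := by
  rw [ENNReal.coe_rpow_of_ne_zero (by norm_num)]
  simp

/-- The competitor h = G turns h + G into 2G, whence the factor 2^s. -/
theorem inf_B12_le_B2 (hs : 0 < s) :
    UniformLE (fun a b f g x => infWeights a b fun k => supOn x b (B12 a b f g α β s k))
      (fun a b f g x => supOn x b (B2 a b f g α β s)) := by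
  refine ⟨2 ^ s, fun a b f g x h => (infWeights_le (isWeight_toNNReal_headInt a b a g)).trans
    (supOn_le_mul_supOn fun y hy => ?_)⟩
  have hG : ∀ t ∈ ivl a b, ((headInt a g t).toNNReal : ℝ≥0∞) = headInt a g t := fun t ht =>
    ENNReal.coe_toNNReal (h.head_lt_top t ht).ne
  have hya := h.mem_of_mem hy
  rw [B12, B2, hG y hya, wInt_congr fun t ht => hG t ⟨hya.1.trans ht.1, ht.2⟩, ← two_mul,
    ENNReal.mul_rpow_of_nonneg _ _ hs.le, coe_two_rpow]
  exact (mul_left_comm _ _ _).le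

theorem inf_B14trunc_le_B4trunc (hα : 0 < α) (hβ : 0 < β) (hs : 0 < s) :
    UniformLE (fun a b f g x => infWeights a b fun k => supOn x b (B14trunc a f g α β s k x))
      (fun a b f g x => supOn x b (B4trunc a f g α β s x)) := by
  refine ⟨2 ^ (β + s), fun a b f g x h =>
    (infWeights_le (isWeight_toNNReal_headInt a b a g)).trans
      (supOn_le_mul_supOn fun y hy => ?_)⟩
  have hG : ∀ t ∈ ivl a b, ((headInt a g t).toNNReal : ℝ≥0∞) = headInt a g t := fun t ht =>
    ENNReal.coe_toNNReal (h.head_lt_top t ht).ne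
  have hq : 0 ≤ (β + s) / α := by positivity
  have hw : wInt x y f (fun t => 2 * headInt a g t) ((β + s) / α)
      = 2 ^ ((β + s) / α) * wInt x y f (headInt a g) ((β + s) / α) := by
    rw [wInt, wInt, ← lintegral_const_mul' _ _ (ENNReal.rpow_ne_top_of_nonneg hq (by simp))]
    refine lintegral_congr fun t => ?_
    rw [ENNReal.mul_rpow_of_nonneg _ _ hq, mul_left_comm]
  rw [B14trunc, B4trunc, hG y (h.mem_of_mem hy), wInt_congr (W' := fun t => 2 * headInt a g t), hw,
    ENNReal.mul_rpow_of_nonneg _ _ hα.le, ← ENNReal.rpow_mul, div_mul_cancel₀ _ hα.ne',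
    coe_two_rpow, mul_assoc]
  intro t ht
  rw [hG t ⟨h.mem.1.trans ht.1, ht.2.trans hy.2⟩, two_mul]

/-- For β ≥ s, G(t) ≥ G(y) under the integral suffices. For β < s monotonicity goes the wrong way,
and the bound passes through the infimum over h. -/
theorem B1_le_B2 (hα : 0 < α) (hβ : 0 < β) (hs : 0 < s) :
    UniformLE (fun a b f g x => supOn x b (B1 a b f g α β))
      (fun a b f g x => supOn x b (B2 a b f g α β s)) := by
  rcases lt_or_ge β s with hβs | hβs
  · exact (B1_le_inf_B12 hα hβ hβs).trans (inf_B12_le_B2 hs)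
  · refine ⟨1, fun a b f g x h => supOn_le_mul_supOn fun y hy => ?_⟩
    rw [B1_eq h hy, B2, wInt_eq_tail h.left (h.mem_of_mem hy).1, ENNReal.coe_one, one_mul]
    calc weightMeasure a b f (Set.Ioi y) ^ α * headInt a g y ^ β
        = (headInt a g y ^ ((β - s) / α) * weightMeasure a b f (Set.Ioi y)) ^ α
            * headInt a g y ^ s := by
          rw [ENNReal.mul_rpow_of_nonneg _ _ hα.le, ← ENNReal.rpow_mul, div_mul_cancel₀ _ hα.ne',
            mul_right_comm, ← ENNReal.rpow_add_of_nonneg _ _ (by linarith) hs.le, sub_add_cancel,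
            mul_comm]
      _ ≤ _ := by
          gcongr
          exact const_mul_measure_le_setLIntegral measurableSet_Ioi fun t ht =>
            ENNReal.rpow_le_rpow (monotone_headInt a g (le_of_lt ht))
              (div_nonneg (by linarith) hα.le)

theorem B2_equiv_B1 (hα : 0 < α) (hβ : 0 < β) (hs : 0 < s) :
    UniformEquiv (fun a b f g x => supOn x b (B1 a b f g α β))
      (fun a b f g x => supOn x b (B2 a b f g α β s)) :=
  (B1_le_B2 hα hβ hs).equiv (B2_le_B1 hα hβ hs)

theorem B4trunc_equiv_B1 (hα : 0 < α) (hβ : 0 < β) (hs : 0 < s) :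
    UniformEquiv (fun a b f g x => supOn x b (B1 a b f g α β))
      (fun a b f g x => supOn x b (B4trunc a f g α β s x)) :=
  ((B1_le_inf_B14trunc hα hβ hs).trans (inf_B14trunc_le_B4trunc hα hβ hs)).equiv
    (B4trunc_le_B1 hα hβ hs)

theorem inf_B12_equiv_B1 (hα : 0 < α) (hβ : 0 < β) (hs : 0 < s) (hβs : β < s) :
    UniformEquiv (fun a b f g x => supOn x b (B1 a b f g α β))
      (fun a b f g x => infWeights a b fun k => supOn x b (B12 a b f g α β s k)) :=
  (B1_le_inf_B12 hα hβ hβs).equiv ((inf_B12_le_B2 hs).trans (B2_le_B1 hα hβ hs))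

theorem inf_B14trunc_equiv_B1 (hα : 0 < α) (hβ : 0 < β) (hs : 0 < s) :
    UniformEquiv (fun a b f g x => supOn x b (B1 a b f g α β))
      (fun a b f g x => infWeights a b fun k => supOn x b (B14trunc a f g α β s k x)) :=
  (B1_le_inf_B14trunc hα hβ hs).equiv
    ((inf_B14trunc_le_B4trunc hα hβ hs).trans (B4trunc_le_B1 hα hβ hs))

end equivalences

/-! ### Reflection t ↦ -t. -/

section reflection

theorem mem_ivl_neg {c d : EReal} {t : ℝ} : t ∈ ivl (-d) (-c) ↔ -t ∈ ivl c d := by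
  simp only [ivl]
  show -d < t ∧ (t : EReal) < -c ↔ c < ((-t : ℝ) : EReal) ∧ ((-t : ℝ) : EReal) < d
  rw [EReal.coe_neg, EReal.lt_neg_comm, EReal.neg_lt_comm, and_comm]

theorem preimage_neg_ivl (c d : EReal) : Neg.neg ⁻¹' ivl c d = ivl (-d) (-c) := by
  ext t
  exact mem_ivl_neg.symm

theorem lintegral_ivl_neg (c d : EReal) (φ : ℝ → ℝ≥0∞) :
    ∫⁻ t in ivl (-d) (-c), φ (-t) = ∫⁻ t in ivl c d, φ t := by
  rw [← preimage_neg_ivl]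
  exact (Measure.measurePreserving_neg volume).setLIntegral_comp_preimage_emb
    (MeasurableEquiv.neg ℝ).measurableEmbedding φ _

theorem tailInt_neg (b : EReal) (f : ℝ → ℝ≥0) (y : ℝ) :
    tailInt b f (-y) = headInt (-b) (fun t => f (-t)) y := by
  rw [tailInt, headInt, ← lintegral_ivl_neg, EReal.coe_neg, neg_neg]

theorem headInt_neg (a : EReal) (g : ℝ → ℝ≥0) (y : ℝ) :
    headInt a g (-y) = tailInt (-a) (fun t => g (-t)) y := by
  rw [tailInt, headInt, ← lintegral_ivl_neg, EReal.coe_neg, neg_neg]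

theorem wInt_neg (c d : EReal) (f : ℝ → ℝ≥0) (W : ℝ → ℝ≥0∞) (p : ℝ) :
    wInt c d f W p = wInt (-d) (-c) (fun t => f (-t)) (fun t => W (-t)) p :=
  (lintegral_ivl_neg c d fun t => f t * W t ^ p).symm

theorem supOn_neg (c d : EReal) (B : ℝ → ℝ≥0∞) :
    supOn c d B = supOn (-d) (-c) fun y => B (-y) := by
  refine le_antisymm (iSup₂_le fun y hy => ?_) (iSup₂_le fun y hy => ?_)
  · have := le_supOn (fun y => B (-y)) (mem_ivl_neg.2 ((neg_neg y).symm ▸ hy) : -y ∈ ivl (-d) (-c))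
    rwa [neg_neg] at this
  · exact le_supOn B (mem_ivl_neg.1 hy)

theorem IsWeight.neg {a b : EReal} {f : ℝ → ℝ≥0} (hf : IsWeight a b f) :
    IsWeight (-b) (-a) fun t => f (-t) := by
  have h := (Measure.measurePreserving_neg (volume : Measure ℝ)).restrict_preimage
    (measurableSet_ivl a b)
  rw [preimage_neg_ivl] at h
  exact hf.comp_quasiMeasurePreserving h.quasiMeasurePreserving

theorem infWeights_neg (a b : EReal) (Φ : (ℝ → ℝ≥0) → ℝ≥0∞) :
    infWeights a b Φ = infWeights (-b) (-a) fun h => Φ fun t => h (-t) := by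
  refine le_antisymm (le_iInf₂ fun h hh => ?_) (le_iInf₂ fun h hh => ?_)
  · have := hh.neg
    rw [neg_neg, neg_neg] at this
    exact infWeights_le this
  · refine (infWeights_le hh.neg).trans_eq ?_
    simp only [neg_neg]

theorem Admissible.neg {a b : EReal} {f g : ℝ → ℝ≥0} {x : ℝ} (h : Admissible a b f g x) :
    Admissible (-b) (-a) (fun t => g (-t)) (fun t => f (-t)) (-x) where
  left := h.right.neg
  right := h.left.neg
  tail_lt_top := fun y hy => by
    rw [← headInt_neg]
    exact h.head_lt_top _ (mem_ivl_neg.1 hy)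
  head_lt_top := fun y hy => by
    rw [← tailInt_neg]
    exact h.tail_lt_top _ (mem_ivl_neg.1 hy)
  mem := mem_ivl_neg.2 (by rw [neg_neg]; exact h.mem)

variable (a b : EReal) (f g h : ℝ → ℝ≥0) (α β s x y : ℝ)

theorem B1_neg : B1 a b f g α β (-y)
    = B1 (-b) (-a) (fun t => g (-t)) (fun t => f (-t)) β α y := by
  rw [B1, B1, tailInt_neg, headInt_neg, mul_comm]

theorem B3_neg : B3 a b f g α β s (-y)
    = B2 (-b) (-a) (fun t => g (-t)) (fun t => f (-t)) β α s y := by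
  simp only [B3, B2, wInt_neg a, tailInt_neg, EReal.coe_neg, neg_neg]

theorem B5trunc_neg : B5trunc b f g α β s x (-y)
    = B4trunc (-b) (fun t => g (-t)) (fun t => f (-t)) β α s (-x) y := by
  simp only [B5trunc, B4trunc, wInt_neg (-(y : EReal)), tailInt_neg, EReal.coe_neg, neg_neg]

theorem B7_neg : B7 a b f g α β s (-y)
    = B6 (-b) (-a) (fun t => g (-t)) (fun t => f (-t)) β α s y := by
  simp only [B7, B6, wInt_neg a, tailInt_neg, headInt_neg, EReal.coe_neg, neg_neg]

theorem B10trunc_neg : B10trunc a b f g α β s x (-y)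
    = B8trunc (-b) (-a) (fun t => g (-t)) (fun t => f (-t)) β α s (-x) y := by
  simp only [B10trunc, B8trunc, wInt_neg (-(y : EReal)), tailInt_neg, headInt_neg,
    EReal.coe_neg, neg_neg]

theorem B11_neg : B11 a b f g α β s (-y)
    = B9 (-b) (-a) (fun t => g (-t)) (fun t => f (-t)) β α s y := by
  simp only [B11, B9, wInt_neg a, tailInt_neg, headInt_neg, EReal.coe_neg, neg_neg]

theorem B13_neg : B13 a b f g α β s (fun t => h (-t)) (-y)
    = B12 (-b) (-a) (fun t => g (-t)) (fun t => f (-t)) β α s h y := by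
  simp only [B13, B12, wInt_neg a, tailInt_neg, EReal.coe_neg, neg_neg]

theorem B15trunc_neg : B15trunc b f g α β s (fun t => h (-t)) x (-y)
    = B14trunc (-b) (fun t => g (-t)) (fun t => f (-t)) β α s h (-x) y := by
  simp only [B15trunc, B14trunc, wInt_neg (-(y : EReal)), tailInt_neg, EReal.coe_neg, neg_neg]

end reflection

/-! ### Transfer to (a, x) and a common constant. -/

/-- Transfer of a uniform equivalence by the reflection `t ↦ -t`. -/
theorem UniformEquiv.neg {L R L' R' : Functional} (h : UniformEquiv L R)
    (hL : ∀ a b f g x, L' a b f g x = L (-b) (-a) (fun t => g (-t)) (fun t => f (-t)) (-x))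
    (hR : ∀ a b f g x, R' a b f g x = R (-b) (-a) (fun t => g (-t)) (fun t => f (-t)) (-x)) :
    UniformEquiv L' R' := by
  obtain ⟨C, hC⟩ := h
  refine ⟨C, fun a b f g x h => ?_⟩
  rw [hL, hR]
  exact hC _ _ _ _ _ h.neg

/-- An admissible constant may be enlarged, so stating this for all large C lets finitely many
equivalences share one constant. -/
theorem UniformEquiv.eventually {L R : Functional} (h : UniformEquiv L R) :
    ∀ᶠ C : ℝ≥0 in Filter.atTop, ∀ a b f g x, Admissible a b f g x →
      EquivWith C (L a b f g x) (R a b f g x) := by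
  obtain ⟨C, hC⟩ := h
  filter_upwards [Filter.eventually_ge_atTop C] with D hD a b f g x h
  exact (hC a b f g x h).mono hD

/-- P does not depend on the data, so C may be chosen after deciding P; if P fails, any C works. -/
theorem eventually_of_imp {P : Prop} {L R : Functional} (h : P → UniformEquiv L R) :
    ∀ᶠ C : ℝ≥0 in Filter.atTop, ∀ a b f g x, Admissible a b f g x →
      P → EquivWith C (L a b f g x) (R a b f g x) := by
  by_cases hP : P
  · filter_upwards [(h hP).eventually] with C hC a b f g x hx _ using hC a b f g x hx
  · exact Filter.Eventually.of_forall fun C a b f g x _ h => absurd h hP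

end HardyScales

open HardyScales
theorem mainTheorem1 (α β s : ℝ) (hα : 0 < α) (hβ : 0 < β) (hs : 0 < s) :
    ∃ C : ℝ≥0, 0 < C ∧
      ∀ (a b : EReal) (f g : ℝ → ℝ≥0),
        HardyScales.IsWeight a b f → HardyScales.IsWeight a b g →
        (∀ y ∈ HardyScales.ivl a b, HardyScales.tailInt b f y < ∞) →
        (∀ y ∈ HardyScales.ivl a b, HardyScales.headInt a g y < ∞) →
        ∀ x ∈ HardyScales.ivl a b,
          (HardyScales.EquivWith C
            (HardyScales.supOn x b (HardyScales.B1 a b f g α β))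
            (HardyScales.supOn x b (HardyScales.B2 a b f g α β s))) ∧
          (HardyScales.EquivWith C
            (HardyScales.supOn x b (HardyScales.B1 a b f g α β))
            (HardyScales.supOn x b (HardyScales.B4trunc a f g α β s x))) ∧
          (HardyScales.EquivWith C
            (HardyScales.supOn x b (HardyScales.B1 a b f g α β))
            (HardyScales.supOn x b (HardyScales.B6 a b f g α β s))) ∧
          (s < α → HardyScales.EquivWith C
            (HardyScales.supOn x b (HardyScales.B1 a b f g α β))
            (HardyScales.supOn x b (HardyScales.B8trunc a b f g α β s x))) ∧
          (α < s → HardyScales.EquivWith C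
            (HardyScales.supOn x b (HardyScales.B1 a b f g α β))
            (HardyScales.supOn x b (HardyScales.B9 a b f g α β s))) ∧
          (β < s → HardyScales.EquivWith C
            (HardyScales.supOn x b (HardyScales.B1 a b f g α β))
            (HardyScales.infWeights a b fun h =>
              HardyScales.supOn x b (HardyScales.B12 a b f g α β s h))) ∧
          (HardyScales.EquivWith C
            (HardyScales.supOn x b (HardyScales.B1 a b f g α β))
            (HardyScales.infWeights a b fun h =>
              HardyScales.supOn x b (HardyScales.B14trunc a f g α β s h x))) ∧
          (HardyScales.EquivWith C
            (HardyScales.supOn a x (HardyScales.B1 a b f g α β))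
            (HardyScales.supOn a x (HardyScales.B3 a b f g α β s))) ∧
          (HardyScales.EquivWith C
            (HardyScales.supOn a x (HardyScales.B1 a b f g α β))
            (HardyScales.supOn a x (HardyScales.B5trunc b f g α β s x))) ∧
          (HardyScales.EquivWith C
            (HardyScales.supOn a x (HardyScales.B1 a b f g α β))
            (HardyScales.supOn a x (HardyScales.B7 a b f g α β s))) ∧
          (s < β → HardyScales.EquivWith C
            (HardyScales.supOn a x (HardyScales.B1 a b f g α β))
            (HardyScales.supOn a x (HardyScales.B10trunc a b f g α β s x))) ∧
          (β < s → HardyScales.EquivWith C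
            (HardyScales.supOn a x (HardyScales.B1 a b f g α β))
            (HardyScales.supOn a x (HardyScales.B11 a b f g α β s))) ∧
          (α < s → HardyScales.EquivWith C
            (HardyScales.supOn a x (HardyScales.B1 a b f g α β))
            (HardyScales.infWeights a b fun h =>
              HardyScales.supOn a x (HardyScales.B13 a b f g α β s h))) ∧
          (HardyScales.EquivWith C
            (HardyScales.supOn a x (HardyScales.B1 a b f g α β))
            (HardyScales.infWeights a b fun h =>
              HardyScales.supOn a x (HardyScales.B15trunc b f g α β s h x))) := by

  have hB1 : ∀ (a b : EReal) (f g : ℝ → ℝ≥0) (x : ℝ), supOn a x (B1 a b f g α β)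
      = supOn (-x : ℝ) (-a) (B1 (-b) (-a) (fun t => g (-t)) (fun t => f (-t)) β α) :=
    fun a b f g x => by
      rw [supOn_neg, EReal.coe_neg]
      exact congrArg _ (funext fun y => B1_neg a b f g α β y)
  have e2 := (B2_equiv_B1 hα hβ hs).eventually
  have e4 := (B4trunc_equiv_B1 hα hβ hs).eventually
  have e6 := (B6_equiv_B1 hα hβ hs).eventually
  have e8 := eventually_of_imp (B8trunc_equiv_B1 hα hβ hs)
  have e9 := eventually_of_imp (B9_equiv_B1 hα hβ hs)
  have e12 := eventually_of_imp (inf_B12_equiv_B1 hα hβ hs)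
  have e14 := (inf_B14trunc_equiv_B1 hα hβ hs).eventually
  have e3 := ((B2_equiv_B1 hβ hα hs).neg
    (R' := fun a b f g x => supOn a x (B3 a b f g α β s)) hB1 fun a b f g x => by
      simp only [supOn_neg a, B3_neg, EReal.coe_neg]).eventually
  have e5 := ((B4trunc_equiv_B1 hβ hα hs).neg
    (R' := fun a b f g x => supOn a x (B5trunc b f g α β s x)) hB1 fun a b f g x => by
      simp only [supOn_neg a, B5trunc_neg, EReal.coe_neg]).eventually
  have e7 := ((B6_equiv_B1 hβ hα hs).neg
    (R' := fun a b f g x => supOn a x (B7 a b f g α β s)) hB1 fun a b f g x => by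
      simp only [supOn_neg a, B7_neg, EReal.coe_neg]).eventually
  have e10 := eventually_of_imp fun hsβ => (B8trunc_equiv_B1 hβ hα hs hsβ).neg
    (R' := fun a b f g x => supOn a x (B10trunc a b f g α β s x)) hB1 fun a b f g x => by
      simp only [supOn_neg a, B10trunc_neg, EReal.coe_neg]
  have e11 := eventually_of_imp fun hβs => (B9_equiv_B1 hβ hα hs hβs).neg
    (R' := fun a b f g x => supOn a x (B11 a b f g α β s)) hB1 fun a b f g x => by
      simp only [supOn_neg a, B11_neg, EReal.coe_neg]
  have e13 := eventually_of_imp fun hαs => (inf_B12_equiv_B1 hβ hα hs hαs).neg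
    (R' := fun a b f g x => infWeights a b fun h => supOn a x (B13 a b f g α β s h)) hB1
    fun a b f g x => by
      simp only [infWeights_neg a, supOn_neg a, B13_neg, EReal.coe_neg]
  have e15 := ((inf_B14trunc_equiv_B1 hβ hα hs).neg
    (R' := fun a b f g x => infWeights a b fun h => supOn a x (B15trunc b f g α β s h x)) hB1
    fun a b f g x => by
      simp only [infWeights_neg a, supOn_neg a, B15trunc_neg, EReal.coe_neg]).eventually
  obtain ⟨C, hC⟩ := (((Filter.eventually_gt_atTop (0 : ℝ≥0)).and
    (e2.and (e4.and (e6.and (e8.and (e9.and (e12.and e14))))))).and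
    (e3.and (e5.and (e7.and (e10.and (e11.and (e13.and e15))))))).exists
  obtain ⟨⟨hC0, h2, h4, h6, h8, h9, h12, h14⟩, h3, h5, h7, h10, h11, h13, h15⟩ := hC
  refine ⟨C, hC0, fun a b f g hf hg hF hG x hx => ?_⟩
  have h : Admissible a b f g x := ⟨hf, hg, hF, hG, hx⟩
  exact ⟨h2 _ _ _ _ _ h, h4 _ _ _ _ _ h, h6 _ _ _ _ _ h, h8 _ _ _ _ _ h, h9 _ _ _ _ _ h,
    h12 _ _ _ _ _ h, h14 _ _ _ _ _ h, h3 _ _ _ _ _ h, h5 _ _ _ _ _ h, h7 _ _ _ _ _ h,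
    h10 _ _ _ _ _ h, h11 _ _ _ _ _ h, h13 _ _ _ _ _ h, h15 _ _ _ _ _ h⟩
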